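/- Let $d\ge 2$, $k\ge 1$, and put $N_d(k)=\binom{d+k-1}{k}+\binom{d+k-2}{k-1}$, $N'_d(k)=2\binom{d+k-2}{k-1}$. A finite set $X\subset\mathbb{R}^d$ is a $k$-distance set if exactly $k$ distances occur between distinct points of $X$, and a locally $k$-distance set if for each $x\in X$ at most $k$ distances occur between $x$ and the other points of $X$; it is antipodal if $X=-X$. For a finite $X\subset S^{d-1}$ and $w:X\to\mathbb{R}_{>0}$ with $\sum_{x\in X}w(x)=1$, the pair $(X,w)$ is a weighted spherical $t$-design if $\frac{1}{|S^{d-1}|}\int_{S^{d-1}}f\,d\sigma=\sum_{x\in X}w(x)f(x)$ for every real polynomial $f$ in $d$ variables of degree at most $t$. It is tight if $|X|=N_d(e)$ when $t=2e$, respectively $|X|=N'_d(e)$ when $t=2e-1$. Let $G_l=G_l^{(d)}$ be the Gegenbauer polynomials given by $G_0=1$, $G_1(s)=d\,s$, $s\,G_l(s)=\lambda_{l+1}G_{l+1}(s)+(1-\lambda_{l-1})G_{l-1}(s)$ for $l\ge1$, where $\lambda_l=\frac{l}{d+2l-2}$ for $l\ge 1$ and $\lambda_0=0$. (i) Let $X\subset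 S^{d-1}$ be a locally $k$-distance set with $|X|=N_d(k)$. For $x\in X$ let $A(x)=\{(x,y): y\in X,\ y\neq x\}$ and expand $$s^{\,k-|A(x)|}\prod_{\alpha\in A(x)}\frac{s-\alpha}{1-\alpha}=\sum_{i=0}^{k}f_i^{(x)}G_i(s).$$ Then, with $w(x)=f_k^{(x)}$, $(X,w)$ is a tight weighted spherical $2k$-design. Conversely, if $(X,w)$ is a tight weighted spherical $2k$-design on $S^{d-1}$, then $X$ is a locally $k$-distance set, and indeed a $k$-distance set. (ii) Let $X\subset S^{d-1}$ be an antipodal locally $k$-distance set with $|X|=N'_d(k)$. For $x\in X$ let $B(x)=\{(x,y)^2: y\in X,\ y\neq\pm x\}\setminus\{0\}$ and expand $$s^{\,k-1-2|B(x)|}\prod_{\beta\in B(x)}\frac{s^2-\beta}{1-\beta}=\sum_{i=0}^{k-1}f_i^{(x)}G_i(s).$$ Then, with $w(x)=f_{k-1}^{(x)}/2$, $(X,w)$ is a tight weighted spherical $(2k-1)$-design. Conversely, if $(X,w)$ is a tight weighted spherical $(2k-1)$-design on $S^{d-1}$, then $X$ is an antipodal locally $k$-distance set, and indeed an antipodal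 $k$-distance set. -/

import Mathlib

open scoped Polynomial

noncomputable section

open Classical in
/-- The set `A(X)` of distances between two distinct points of `X`. -/
def distanceSet {d : ℕ} (X : Finset (EuclideanSpace ℝ (Fin d))) : Finset ℝ :=
  X.offDiag.image fun p => dist p.1 p.2

open Classical in
/-- The set `A_X(x)` of distances between `x` and the other points of `X`. -/
def localDistanceSet {d : ℕ} (X : Finset (EuclideanSpace ℝ (Fin d)))
    (x : EuclideanSpace ℝ (Fin d)) : Finset ℝ :=
  (X.erase x).image fun y => dist x y

/-- `X` is a `k`-distance set: exactly `k` distances occur. -/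
def IsKDistanceSet {d : ℕ} (k : ℕ) (X : Finset (EuclideanSpace ℝ (Fin d))) : Prop :=
  (distanceSet X).card = k

/-- `X` is a locally `k`-distance set: at most `k` distances occur from each point. -/
def IsLocallyKDistanceSet {d : ℕ} (k : ℕ) (X : Finset (EuclideanSpace ℝ (Fin d))) : Prop :=
  ∀ x ∈ X, (localDistanceSet X x).card ≤ k

/-- `X` lies on the unit sphere `S^{d-1}`. -/
def OnUnitSphere {d : ℕ} (X : Finset (EuclideanSpace ℝ (Fin d))) : Prop :=
  ∀ x ∈ X, x ∈ Metric.sphere (0 : EuclideanSpace ℝ (Fin d)) 1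

/-- `X` is antipodal. -/
def IsAntipodal {d : ℕ} (X : Finset (EuclideanSpace ℝ (Fin d))) : Prop :=
  ∀ x ∈ X, -x ∈ X

/-- `N_d(k)`, for `d ≥ 2` and `k ≥ 1`. -/
def fisherN (d k : ℕ) : ℕ := (d + k - 1).choose k + (d + k - 2).choose (k - 1)

/-- `N'_d(k)`, for `d ≥ 2` and `k ≥ 1`. -/
def fisherN' (d k : ℕ) : ℕ := 2 * (d + k - 2).choose (k - 1)

/-- The normalized surface integral `(1/|S^{d-1}|) ∫ f dσ` of a polynomial over `S^{d-1}`. -/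
def sphereMean {d : ℕ} (f : MvPolynomial (Fin d) ℝ) : ℝ :=
  ((MeasureTheory.volume : MeasureTheory.Measure (EuclideanSpace ℝ (Fin d))).toSphere.real
      Set.univ)⁻¹ *
    ∫ x : Metric.sphere (0 : EuclideanSpace ℝ (Fin d)) 1,
      MvPolynomial.eval (fun i => (x : EuclideanSpace ℝ (Fin d)) i) f
      ∂(MeasureTheory.volume : MeasureTheory.Measure (EuclideanSpace ℝ (Fin d))).toSphere

/-- `(X, w)` is a weighted spherical `t`-design (only the values of `w` on `X` matter). -/
structure IsWeightedSphericalDesign {d : ℕ} (X : Finset (EuclideanSpace ℝ (Fin d)))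
    (w : EuclideanSpace ℝ (Fin d) → ℝ) (t : ℕ) : Prop where
  onSphere : OnUnitSphere X
  weight_pos : ∀ x ∈ X, 0 < w x
  weight_sum : ∑ x ∈ X, w x = 1
  mean_eq : ∀ f : MvPolynomial (Fin d) ℝ, f.totalDegree ≤ t →
    sphereMean f = ∑ x ∈ X, w x * MvPolynomial.eval (fun i => x i) f

/-- The Fisher-type lower bound for the size of a weighted spherical `t`-design, `t ≥ 1`:
`N_d(e)` if `t = 2e`, and `N'_d(e)` if `t = 2e - 1`. -/
def fisherBound (d t : ℕ) : ℕ :=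
  if Even t then fisherN d (t / 2) else fisherN' d ((t + 1) / 2)

/-- `(X, w)` is a tight weighted spherical `t`-design: the Fisher-type bound is attained. -/
def IsTightWeightedSphericalDesign {d : ℕ} (X : Finset (EuclideanSpace ℝ (Fin d)))
    (w : EuclideanSpace ℝ (Fin d) → ℝ) (t : ℕ) : Prop :=
  IsWeightedSphericalDesign X w t ∧ X.card = fisherBound d t

/-- `λ_l = l / (d + 2l - 2)`; for `d = 2`, `λ_0 = 0`. -/
def gegenbauerLambda (d l : ℕ) : ℝ := (l : ℝ) / ((d : ℝ) + 2 * (l : ℝ) - 2)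

/-- The Gegenbauer polynomials `G_l^{(d)}`: `G_0 = 1`, `G_1 = d t` and
`t G_{l+1} = λ_{l+2} G_{l+2} + (1 - λ_l) G_l`. -/
def gegenbauerG (d : ℕ) : ℕ → ℝ[X]
  | 0 => 1
  | 1 => Polynomial.C (d : ℝ) * Polynomial.X
  | l + 2 => Polynomial.C (gegenbauerLambda d (l + 2))⁻¹ *
      (Polynomial.X * gegenbauerG d (l + 1) -
        Polynomial.C (1 - gegenbauerLambda d l) * gegenbauerG d l)

open Classical in
/-- The set of inner products of `x` with the other points of `X`. -/
def innerSet {d : ℕ} (X : Finset (EuclideanSpace ℝ (Fin d)))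
    (x : EuclideanSpace ℝ (Fin d)) : Finset ℝ :=
  (X.erase x).image fun y => inner ℝ x y

open Classical in
/-- The set of nonzero squared inner products of `x` with the points of `X` other than `±x`. -/
def innerSqSet {d : ℕ} (X : Finset (EuclideanSpace ℝ (Fin d)))
    (x : EuclideanSpace ℝ (Fin d)) : Finset ℝ :=
  (((X.erase x).erase (-x)).image fun y => (inner ℝ x y) ^ 2).erase 0

/-- The degree `k` annihilator of `x`, as a polynomial in the variable `(x, ξ)`. -/
def annihilator {d : ℕ} (k : ℕ) (X : Finset (EuclideanSpace ℝ (Fin d)))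
    (x : EuclideanSpace ℝ (Fin d)) : ℝ[X] :=
  Polynomial.X ^ (k - (innerSet X x).card) *
    ∏ α ∈ innerSet X x, (Polynomial.C (1 - α)⁻¹ * (Polynomial.X - Polynomial.C α))

/-- The degree `k - 1` annihilator of `x` for antipodal sets, as a polynomial in the
variable `(x, ξ)`. -/
def antipodalAnnihilator {d : ℕ} (k : ℕ) (X : Finset (EuclideanSpace ℝ (Fin d)))
    (x : EuclideanSpace ℝ (Fin d)) : ℝ[X] :=
  Polynomial.X ^ (k - 1 - 2 * (innerSqSet X x).card) *
    ∏ β ∈ innerSqSet X x, (Polynomial.C (1 - β)⁻¹ * (Polynomial.X ^ 2 - Polynomial.C β))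

/-- `P = ∑_{i ≤ n} f_i G_i^{(d)}` is the Gegenbauer expansion of `P`. -/
def IsGegenbauerExpansion (d n : ℕ) (P : ℝ[X]) (f : ℕ → ℝ) : Prop :=
  P = ∑ i ∈ Finset.range (n + 1), Polynomial.C (f i) * gegenbauerG d i

end

/-! The number `fisherN d k` is the dimension of `Hom_k ⊕ Hom_{k-1}` (homogeneous polynomials of
degrees `k` and `k - 1`), and `fisherN' d k` is twice the dimension of `Hom_{k-1}`. Both directions
compare these spaces with the functions on `X`.

From distances to designs: made homogeneous with powers of `|ξ|²`, the annihilators are dual to the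
points of `X` (in the antipodal case, to one point from each pair `±x`). Since the cardinality
equals the dimension, they form a basis, so every `g` in the space is interpolated as `∑ g(x) F_x`
(`eq_sum_eval_smul_of_dual`), also over `ℂ`. Let `u` be a complex isotropic vector and `n` the
degree of the annihilators. Integrating `F_x` against `(u,ξ)^n` sees only the leading coefficient of
`F_x` and returns `w(x) (x,u)^n` (`momentMap_zonal_mul_isotropic_pow`), where `w(x)` is the top
Gegenbauer coefficient. The cubature is therefore exact on all products `g (u,ξ)^n`. For real `a`,
the form `(a,ξ)` is half the sum of two isotropic forms, so its `m`-th power is a combination of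
such products once `2n ≤ m + 1` (`map_linForm_pow_eq_zero_of_isotropic`). Powers of linear forms
span, and lower degrees of the same parity follow from `|ξ|² = 1`.

From designs to distances: let `C` be the zonal reproducing kernel of `Hom_e`
(`exists_isHomogeneousKernel`). In even strength, tightness makes evaluation at `X` bijective, and
reproducing the indicator functions shows that all inner products are roots of a polynomial of
degree at most `k`. In odd strength, a trace computation gives `|X| = 2 C(1)`; applying the design
to `C(s)² (1 ± s)` then forces equal weights, antipodality, and inner products that are `-1` or
roots of `C`. Fewer than `k` distances are impossible: a nonzero nonnegative polynomial of
admissible degree would vanish on the design.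

All integrals are obtained from one recursion for sphere moments, `momentMap_linForm_pow_succ_mul`.
-/

open MeasureTheory

/-! ### Gaussian moments on the line and the half-line. -/

/-- Moments of `exp (-t ^ 2)` on the line. -/
noncomputable def gaussianMoment (n : ℕ) : ℝ := ∫ t : ℝ, t ^ n * Real.exp (-t ^ 2)

/-- Radial moments of `exp (-r ^ 2)` on the half-line. -/
noncomputable def radialMoment (n : ℕ) : ℝ :=
  ∫ r in Set.Ioi (0 : ℝ), r ^ n * Real.exp (-r ^ 2)

theorem integrable_pow_mul_exp_neg_sq (n : ℕ) :
    Integrable fun t : ℝ => t ^ n * Real.exp (-t ^ 2) := by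
  have h := integrable_rpow_mul_exp_neg_mul_sq (b := 1) one_pos (s := n)
    (by have : (0 : ℝ) ≤ n := n.cast_nonneg
        linarith)
  simpa using h

theorem hasDerivAt_pow_mul_exp_neg_sq (n : ℕ) (t : ℝ) :
    HasDerivAt (fun t : ℝ => t ^ n * Real.exp (-t ^ 2))
      (n * (t ^ (n - 1) * Real.exp (-t ^ 2)) - 2 * (t ^ (n + 1) * Real.exp (-t ^ 2))) t := by
  have h1 : HasDerivAt (fun t : ℝ => t ^ n) (n * t ^ (n - 1)) t := hasDerivAt_pow n t
  have h2 : HasDerivAt (fun t : ℝ => Real.exp (-t ^ 2)) (Real.exp (-t ^ 2) * (-(2 * t))) t := by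
    have := ((hasDerivAt_pow 2 t).neg).exp
    simpa using this
  refine (h1.mul h2).congr_deriv ?_
  ring

theorem two_mul_gaussianMoment_succ (n : ℕ) :
    2 * gaussianMoment (n + 1) = n * gaussianMoment (n - 1) := by
  have h := integral_eq_zero_of_hasDerivAt_of_integrable (hasDerivAt_pow_mul_exp_neg_sq n)
    (((integrable_pow_mul_exp_neg_sq _).const_mul _).sub
      ((integrable_pow_mul_exp_neg_sq _).const_mul _)) (integrable_pow_mul_exp_neg_sq n)
  rw [integral_sub ((integrable_pow_mul_exp_neg_sq _).const_mul _)
      ((integrable_pow_mul_exp_neg_sq _).const_mul _), integral_const_mul,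
    integral_const_mul] at h
  simp only [gaussianMoment]
  linarith

theorem radialMoment_eq_gamma (n : ℕ) :
    radialMoment n = 1 / 2 * Real.Gamma ((n + 1) / 2) := by
  have h := integral_rpow_mul_exp_neg_rpow (p := 2) (q := n) (by norm_num)
    (by have : (0 : ℝ) ≤ n := n.cast_nonneg
        linarith)
  rw [← h, radialMoment]
  simp

theorem radialMoment_pos (n : ℕ) : 0 < radialMoment n := by
  rw [radialMoment_eq_gamma]
  have : 0 < Real.Gamma (((n : ℝ) + 1) / 2) := Real.Gamma_pos_of_pos (by positivity)
  positivity

theorem two_mul_radialMoment_add_two (n : ℕ) :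
    2 * radialMoment (n + 2) = (n + 1) * radialMoment n := by
  rw [radialMoment_eq_gamma, radialMoment_eq_gamma]
  have : (((n + 2 : ℕ) : ℝ) + 1) / 2 = ((n : ℝ) + 1) / 2 + 1 := by push_cast; ring
  rw [this, Real.Gamma_add_one (by positivity)]
  ring

/-! ### The mean over the sphere and its monomial moments. -/

section Sphere

variable {d : ℕ}

theorem continuous_eval_sphere (f : MvPolynomial (Fin d) ℝ) :
    Continuous fun x : Metric.sphere (0 : EuclideanSpace ℝ (Fin d)) 1 =>
      MvPolynomial.eval (fun i => (x : EuclideanSpace ℝ (Fin d)) i) f := by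
  apply (MvPolynomial.continuous_eval f).comp
  fun_prop

theorem integrable_eval_sphere (f : MvPolynomial (Fin d) ℝ) :
    Integrable (fun x : Metric.sphere (0 : EuclideanSpace ℝ (Fin d)) 1 =>
      MvPolynomial.eval (fun i => (x : EuclideanSpace ℝ (Fin d)) i) f)
      (volume : Measure (EuclideanSpace ℝ (Fin d))).toSphere :=
  (continuous_eval_sphere f).integrable_of_hasCompactSupport (HasCompactSupport.of_compactSpace _)

/-- `sphereMean` as a linear functional. -/
noncomputable def sphereMeanLinear (d : ℕ) : MvPolynomial (Fin d) ℝ →ₗ[ℝ] ℝ where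
  toFun := sphereMean
  map_add' f g := by
    simp only [sphereMean, map_add]
    rw [integral_add (integrable_eval_sphere f) (integrable_eval_sphere g), mul_add]
  map_smul' c f := by
    simp only [sphereMean, MvPolynomial.smul_eval, RingHom.id_apply, smul_eq_mul]
    rw [integral_const_mul]
    ring

@[simp] theorem sphereMeanLinear_apply (f : MvPolynomial (Fin d) ℝ) :
    sphereMeanLinear d f = sphereMean f := rfl

theorem sphereMean_congr {f g : MvPolynomial (Fin d) ℝ}
    (h : ∀ x : EuclideanSpace ℝ (Fin d), ‖x‖ = 1 →
      MvPolynomial.eval (fun i => x i) f = MvPolynomial.eval (fun i => x i) g) :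
    sphereMean f = sphereMean g := by
  simp only [sphereMean]
  congr 2
  ext x
  exact h x (by simp)

theorem toSphere_real_univ_pos (hd : 1 ≤ d) :
    0 < (volume : Measure (EuclideanSpace ℝ (Fin d))).toSphere.real Set.univ := by
  have : Nonempty (Fin d) := ⟨⟨0, hd⟩⟩
  rw [measureReal_def, ENNReal.toReal_pos_iff]
  refine ⟨?_, measure_lt_top _ _⟩
  rw [pos_iff_ne_zero, Ne, Measure.measure_univ_eq_zero]
  exact Measure.toSphere_ne_zero _

theorem sphereMean_one (hd : 1 ≤ d) : sphereMean (1 : MvPolynomial (Fin d) ℝ) = 1 := by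
  have := toSphere_real_univ_pos hd
  simp only [sphereMean, map_one, integral_const, smul_eq_mul, mul_one]
  exact inv_mul_cancel₀ this.ne'

theorem eval_eq_zero_of_sphereMean_eq_zero (hd : 1 ≤ d) {f : MvPolynomial (Fin d) ℝ}
    (hnn : ∀ x : EuclideanSpace ℝ (Fin d), ‖x‖ = 1 → 0 ≤ MvPolynomial.eval (fun i => x i) f)
    (h0 : sphereMean f = 0) (x : EuclideanSpace ℝ (Fin d)) (hx : ‖x‖ = 1) :
    MvPolynomial.eval (fun i => x i) f = 0 := by
  have hpos := toSphere_real_univ_pos hd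
  simp only [sphereMean, mul_eq_zero, inv_eq_zero, hpos.ne', false_or] at h0
  have hnn' : ∀ y : Metric.sphere (0 : EuclideanSpace ℝ (Fin d)) 1,
      0 ≤ MvPolynomial.eval (fun i => (y : EuclideanSpace ℝ (Fin d)) i) f :=
    fun y => hnn y (by simp)
  have h1 := (integral_eq_zero_iff_of_nonneg hnn' (integrable_eval_sphere f)).1 h0
  have h2 := (Continuous.ae_eq_iff_eq _ (continuous_eval_sphere f) continuous_const).1 h1
  exact congrFun h2 ⟨x, by simpa using hx⟩

/-- The integral of `x^α exp(-|x|²)` over the whole space is computed twice: by coordinates it is a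
product of line moments, in polar coordinates a sphere integral times a radial moment. The shift `d
- 1` is the polar Jacobian. -/
theorem sphere_integral_mul_radialMoment (hd : 1 ≤ d) (α : Fin d →₀ ℕ) :
    (∫ x : Metric.sphere (0 : EuclideanSpace ℝ (Fin d)) 1,
        (∏ i, (x : EuclideanSpace ℝ (Fin d)) i ^ α i)
        ∂(volume : Measure (EuclideanSpace ℝ (Fin d))).toSphere) *
      radialMoment (d - 1 + α.degree) = ∏ i, gaussianMoment (α i) := by
  have : Nonempty (Fin d) := ⟨⟨0, hd⟩⟩
  have hG : ∏ i, gaussianMoment (α i) =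
      ∫ x : EuclideanSpace ℝ (Fin d), (∏ i, x i ^ α i) * Real.exp (-‖x‖ ^ 2) := by
    simp only [gaussianMoment]
    rw [← integral_fintype_prod_volume_eq_prod
        (f := fun i (t : ℝ) => t ^ α i * Real.exp (-t ^ 2)),
      ← (PiLp.volume_preserving_ofLp (Fin d)).integral_comp
        (MeasurableEquiv.toLp 2 (Fin d → ℝ)).symm.measurableEmbedding]
    congr 1
    ext x
    rw [EuclideanSpace.real_norm_sq_eq, Finset.prod_mul_distrib, ← Real.exp_sum,
      Finset.sum_neg_distrib]
  have hR : radialMoment (d - 1 + α.degree) =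
      ∫ r : Set.Ioi (0 : ℝ), (r : ℝ) ^ α.degree * Real.exp (-(r : ℝ) ^ 2)
        ∂Measure.volumeIoiPow (d - 1) := by
    simp only [Measure.volumeIoiPow, ENNReal.ofReal]
    rw [integral_withDensity_eq_integral_smul,
      integral_subtype_comap measurableSet_Ioi
        fun a => Real.toNNReal (a ^ (d - 1)) • (a ^ α.degree * Real.exp (-a ^ 2)),
      radialMoment]
    · refine setIntegral_congr_fun measurableSet_Ioi fun x hx => ?_
      rw [NNReal.smul_def, Real.coe_toNNReal _ (pow_nonneg hx.out.le _), smul_eq_mul]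
      ring
    · exact (measurable_subtype_coe.pow_const _).real_toNNReal
  rw [hG, hR, ← integral_prod_mul]
  have hmp := (volume : Measure (EuclideanSpace ℝ (Fin d))).measurePreserving_homeomorphUnitSphereProd
  rw [finrank_euclideanSpace_fin] at hmp
  have hcomap : ∫ x : EuclideanSpace ℝ (Fin d), (∏ i, x i ^ α i) * Real.exp (-‖x‖ ^ 2) =
      ∫ x : ({0}ᶜ : Set (EuclideanSpace ℝ (Fin d))),
        (∏ i, x.1 i ^ α i) * Real.exp (-‖x.1‖ ^ 2)
          ∂((volume : Measure (EuclideanSpace ℝ (Fin d))).comap Subtype.val) := by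
    rw [integral_subtype_comap (measurableSet_singleton _).compl
      fun x : EuclideanSpace ℝ (Fin d) => (∏ i, x i ^ α i) * Real.exp (-‖x‖ ^ 2),
      restrict_compl_singleton]
  rw [← hmp.integral_comp (Homeomorph.measurableEmbedding _), hcomap]
  congr 1
  ext x
  have hx : ‖(x : EuclideanSpace ℝ (Fin d))‖ ≠ 0 := by
    exact norm_ne_zero_iff.2 x.2
  simp only [homeomorphUnitSphereProd_apply_snd_coe, homeomorphUnitSphereProd_apply_fst_coe]
  rw [← mul_assoc]
  congr 1
  simp only [PiLp.smul_apply, smul_eq_mul, mul_pow, Finset.prod_mul_distrib,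
    Finset.prod_pow_eq_pow_sum, Finsupp.degree_eq_sum]
  rw [mul_comm, ← mul_assoc, ← mul_pow, mul_inv_cancel₀ hx, one_pow, one_mul]


theorem two_mul_prod_gaussianMoment_add_single (α : Fin d →₀ ℕ) (i : Fin d) :
    2 * ∏ j, gaussianMoment ((α + Finsupp.single i 1 : Fin d →₀ ℕ) j) =
      α i * ∏ j, gaussianMoment ((α - Finsupp.single i 1 : Fin d →₀ ℕ) j) := by
  have h1 : ∏ j ∈ Finset.univ.erase i, gaussianMoment ((α + Finsupp.single i 1 : Fin d →₀ ℕ) j) =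
      ∏ j ∈ Finset.univ.erase i, gaussianMoment ((α - Finsupp.single i 1 : Fin d →₀ ℕ) j) := by
    refine Finset.prod_congr rfl fun j hj => ?_
    have : i ≠ j := (Finset.ne_of_mem_erase hj).symm
    simp [this]
  rw [← Finset.mul_prod_erase _ _ (Finset.mem_univ i),
    ← Finset.mul_prod_erase _ (fun j => gaussianMoment ((α - Finsupp.single i 1 : Fin d →₀ ℕ) j))
      (Finset.mem_univ i), h1, ← mul_assoc, ← mul_assoc]
  congr 1
  simpa using two_mul_gaussianMoment_succ (α i)

/-- The moments of the normalized surface measure. -/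
noncomputable def sphereMoment (α : Fin d →₀ ℕ) : ℝ := sphereMean (MvPolynomial.monomial α 1)

theorem sphereMoment_mul_radialMoment (hd : 1 ≤ d) (α : Fin d →₀ ℕ) :
    (volume : Measure (EuclideanSpace ℝ (Fin d))).toSphere.real Set.univ *
      sphereMoment α * radialMoment (d - 1 + α.degree) = ∏ i, gaussianMoment (α i) := by
  rw [← sphere_integral_mul_radialMoment hd, sphereMoment, sphereMean, ← mul_assoc,
    mul_inv_cancel₀ (toSphere_real_univ_pos hd).ne', one_mul]
  simp only [MvPolynomial.eval_monomial, one_mul]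
  congr 2
  ext x
  rw [Finsupp.prod_fintype]
  simp

/-- Integration by parts on the sphere, in monomial form. Divide the recursion for the line moments
by the one for the radial moments; the surface area and the radial factor cancel. -/
theorem sphereMoment_add_single (hd : 1 ≤ d) (α : Fin d →₀ ℕ) (i : Fin d) :
    ((d : ℝ) + α.degree - 1) * sphereMoment (α + Finsupp.single i 1) =
      α i * sphereMoment (α - Finsupp.single i 1) := by
  have hσ := toSphere_real_univ_pos hd
  have h1 := sphereMoment_mul_radialMoment hd (α + Finsupp.single i 1)
  have h2 := sphereMoment_mul_radialMoment hd (α - Finsupp.single i 1)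
  have h3 := two_mul_prod_gaussianMoment_add_single α i
  rw [← h1, ← h2] at h3
  set σ := (volume : Measure (EuclideanSpace ℝ (Fin d))).toSphere.real Set.univ
  have hdeg : (α + Finsupp.single i 1).degree = α.degree + 1 := by simp
  -- If `α i = 0`, truncated subtraction leaves `α` unchanged and the degree count below fails; both
  -- sides are then zero.
  rcases Nat.eq_zero_or_pos (α i) with h0 | hpos
  · have hR := radialMoment_pos (d - 1 + (α + Finsupp.single i 1).degree)
    rw [h0, Nat.cast_zero, zero_mul] at h3 ⊢
    have h4 : sphereMoment (α + Finsupp.single i 1) = 0 := by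
      by_contra h
      have : σ * sphereMoment (α + Finsupp.single i 1) *
        radialMoment (d - 1 + (α + Finsupp.single i 1).degree) ≠ 0 :=
        mul_ne_zero (mul_ne_zero hσ.ne' h) hR.ne'
      exact this (by linarith)
    rw [h4, mul_zero]
  · have hsub : α - Finsupp.single i 1 + Finsupp.single i 1 = α := by
      apply tsub_add_cancel_of_le
      simpa [Finsupp.single_le_iff, Nat.one_le_iff_ne_zero] using hpos.ne'
    have hdeg' : (α - Finsupp.single i 1).degree + 1 = α.degree := by
      conv_rhs => rw [← hsub]
      simp
    have e1 : d - 1 + (α + Finsupp.single i 1).degree =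
        d - 1 + (α - Finsupp.single i 1).degree + 2 := by
      rw [hdeg, ← hdeg']; ring
    have hR := radialMoment_pos (d - 1 + (α - Finsupp.single i 1).degree)
    have h4 := two_mul_radialMoment_add_two (d - 1 + (α - Finsupp.single i 1).degree)
    have e2 : ((d - 1 + (α - Finsupp.single i 1).degree : ℕ) : ℝ) + 1 =
        (d : ℝ) + α.degree - 1 := by
      rw [← hdeg']
      push_cast [hd]
      ring
    rw [e1] at h3
    rw [e2] at h4
    have h5 : σ * radialMoment (d - 1 + (α - Finsupp.single i 1).degree) ≠ 0 :=
      mul_ne_zero hσ.ne' hR.ne'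
    apply mul_left_cancel₀ h5
    linear_combination h3 - σ * sphereMoment (α + Finsupp.single i 1) * h4

end Sphere

/-! ### Linear forms and the moment functional over an extension of `ℝ`. -/

section LinearForm

open MvPolynomial

/-- The squared Euclidean norm as a polynomial. -/
noncomputable def normSqPoly (d : ℕ) (K : Type*) [Field K] : MvPolynomial (Fin d) K :=
  ∑ i, X i ^ 2

variable {d : ℕ} {K : Type*} [Field K]

/-- The linear form with coefficient vector `a`. -/
noncomputable def linForm (a : Fin d → K) : MvPolynomial (Fin d) K := ∑ i, C (a i) * X i

theorem linForm_isHomogeneous (a : Fin d → K) : (linForm a).IsHomogeneous 1 :=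
  IsHomogeneous.sum _ _ _ fun i _ => by
    simpa using (isHomogeneous_C _ (a i)).mul (isHomogeneous_X K i)

theorem normSqPoly_isHomogeneous : (normSqPoly d K).IsHomogeneous 2 :=
  IsHomogeneous.sum _ _ _ fun i _ => by
    simpa using (isHomogeneous_X K i).pow 2

theorem eval_linForm (a v : Fin d → K) : eval v (linForm a) = a ⬝ᵥ v := by
  simp [linForm, dotProduct]

theorem eval_normSqPoly (v : Fin d → K) : eval v (normSqPoly d K) = v ⬝ᵥ v := by
  simp [normSqPoly, dotProduct, sq]

theorem pderiv_linForm (a : Fin d → K) (i : Fin d) : pderiv i (linForm a) = C (a i) := by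
  simp [linForm, pderiv_X, Pi.single_apply]

end LinearForm

section MomentMap

open MvPolynomial

variable {d : ℕ} (K : Type*) [Field K] [Algebra ℝ K]

/-- The extension of scalars of `sphereMean`. -/
noncomputable def momentMap : MvPolynomial (Fin d) K →ₗ[K] K :=
  (basisMonomials (Fin d) K).constr K fun α => algebraMap ℝ K (sphereMoment α)

theorem momentMap_monomial (α : Fin d →₀ ℕ) (c : K) :
    momentMap K (monomial α c) = c * algebraMap ℝ K (sphereMoment α) := by
  have h1 : monomial α c = c • basisMonomials (Fin d) K α := by
    simp [smul_monomial]
  rw [h1, map_smul, momentMap, Module.Basis.constr_basis, smul_eq_mul]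

theorem momentMap_real (f : MvPolynomial (Fin d) ℝ) : momentMap ℝ f = sphereMean f := by
  have : momentMap ℝ = sphereMeanLinear d := by
    refine (basisMonomials (Fin d) ℝ).ext fun α => ?_
    rw [coe_basisMonomials, momentMap_monomial, sphereMeanLinear_apply, sphereMoment]
    simp
  rw [this, sphereMeanLinear_apply]

theorem momentMap_map (f : MvPolynomial (Fin d) ℝ) :
    momentMap K (map (algebraMap ℝ K) f) = algebraMap ℝ K (sphereMean f) := by
  rw [← momentMap_real]
  induction f using MvPolynomial.induction_on' with
  | monomial α c => simp [momentMap_monomial]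
  | add p q hp hq => simp [hp, hq]

theorem sphereMean_normSqPoly_mul (f : MvPolynomial (Fin d) ℝ) :
    sphereMean (normSqPoly d ℝ * f) = sphereMean f := by
  refine sphereMean_congr fun x hx => ?_
  have : ∑ i, x i ^ 2 = 1 := by rw [← EuclideanSpace.real_norm_sq_eq, hx, one_pow]
  simp [normSqPoly, this]

theorem momentMap_normSqPoly_mul (f : MvPolynomial (Fin d) K) :
    momentMap K (normSqPoly d K * f) = momentMap K f := by
  induction f using MvPolynomial.induction_on' with
  | monomial α c =>
    have h1 : normSqPoly d K * monomial α c =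
        c • map (algebraMap ℝ K) (normSqPoly d ℝ * monomial α 1) := by
      simp [normSqPoly, smul_monomial, ← mul_smul_comm]
    rw [h1, map_smul, momentMap_map, sphereMean_normSqPoly_mul, momentMap_monomial, sphereMoment,
      smul_eq_mul]
  | add p q hp hq => simp [mul_add, hp, hq]

theorem momentMap_normSqPoly_pow_mul (n : ℕ) (f : MvPolynomial (Fin d) K) :
    momentMap K (normSqPoly d K ^ n * f) = momentMap K f := by
  induction n with
  | zero => simp
  | succ n ih => rw [pow_succ', mul_assoc, momentMap_normSqPoly_mul, ih]

variable {K}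

/-- Homogeneity gives all monomials of `f` the same factor `d + n - 1`, so the monomial recursion
adds up. -/
theorem momentMap_X_mul (hd : 1 ≤ d) {f : MvPolynomial (Fin d) K} {n : ℕ}
    (hf : f.IsHomogeneous n) (i : Fin d) :
    ((d : K) + n - 1) * momentMap K (X i * f) = momentMap K (pderiv i f) := by
  rw [← support_sum_monomial_coeff f, Finset.mul_sum, map_sum, map_sum, map_sum, Finset.mul_sum]
  refine Finset.sum_congr rfl fun α hα => ?_
  have hdeg : α.degree = n := by
    rw [Finsupp.degree_eq_weight_one]
    exact hf (mem_support_iff.1 hα)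
  have h1 : X i * monomial α (coeff α f) =
      monomial (α + Finsupp.single i 1) (coeff α f) := by
    rw [X, monomial_mul, one_mul, add_comm]
  have h2 := congrArg (algebraMap ℝ K) (sphereMoment_add_single hd α i)
  rw [hdeg] at h2
  simp only [map_mul, map_sub, map_add, map_natCast, map_one] at h2
  rw [h1, momentMap_monomial, pderiv_monomial, momentMap_monomial]
  linear_combination (coeff α f) * h2

theorem momentMap_linForm_mul (hd : 1 ≤ d) (a : Fin d → K) {f : MvPolynomial (Fin d) K} {n : ℕ}
    (hf : f.IsHomogeneous n) :
    ((d : K) + n - 1) * momentMap K (linForm a * f) =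
      ∑ i, a i * momentMap K (pderiv i f) := by
  simp only [linForm, Finset.sum_mul, map_sum, Finset.mul_sum, ← smul_eq_C_mul,
    map_smul, smul_mul_assoc, smul_eq_mul]
  refine Finset.sum_congr rfl fun i _ => ?_
  rw [← momentMap_X_mul hd hf i]
  ring

/-- Integration by parts along `a`: differentiating a power of a linear form produces a dot product.
All later moment computations specialise this recursion, with truncated exponents always multiplied
by zero. -/
theorem momentMap_linForm_pow_succ_mul (hd : 1 ≤ d) (a c : Fin d → K) (j n : ℕ) :
    ((d : K) + j + n - 1) * momentMap K (linForm a ^ (j + 1) * linForm c ^ n) =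
      j * (a ⬝ᵥ a) * momentMap K (linForm a ^ (j - 1) * linForm c ^ n) +
      n * (a ⬝ᵥ c) * momentMap K (linForm a ^ j * linForm c ^ (n - 1)) := by
  have hhom : (linForm a ^ j * linForm c ^ n).IsHomogeneous (j + n) := by
    simpa using ((linForm_isHomogeneous a).pow j).mul ((linForm_isHomogeneous c).pow n)
  have h := momentMap_linForm_mul hd a hhom
  rw [← mul_assoc, ← pow_succ'] at h
  push_cast at h
  rw [← add_assoc] at h
  rw [h]
  simp only [dotProduct, Finset.mul_sum, Finset.sum_mul, ← Finset.sum_add_distrib]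
  refine Finset.sum_congr rfl fun i _ => ?_
  have : pderiv i (linForm a ^ j * linForm c ^ n) =
      ((j : K) * a i) • (linForm a ^ (j - 1) * linForm c ^ n) +
        ((n : K) * c i) • (linForm a ^ j * linForm c ^ (n - 1)) := by
    rw [pderiv_mul, pderiv_pow, pderiv_pow, pderiv_linForm, pderiv_linForm, smul_eq_C_mul,
      smul_eq_C_mul]
    simp only [C_mul, map_natCast]
    ring
  rw [this, map_add, map_smul, map_smul, smul_eq_mul, smul_eq_mul]
  ring

end MomentMap

/-! ### Homogeneous polynomials: interpolation, spanning by powers, zonal polynomials. -/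

section Homogeneous

open MvPolynomial

variable {d : ℕ} {K : Type*} [Field K]

/-- The exponents of total degree `n` in `d` variables. -/
noncomputable def degreeExponents (d n : ℕ) : Finset (Fin d →₀ ℕ) :=
  (Finset.univ : Finset (Fin d)).finsuppAntidiag n

theorem mem_degreeExponents {n : ℕ} {α : Fin d →₀ ℕ} :
    α ∈ degreeExponents d n ↔ α.degree = n := by
  simp [degreeExponents, Finset.mem_finsuppAntidiag, Finsupp.degree_eq_sum]

theorem card_degreeExponents (d n : ℕ) :
    (degreeExponents d n).card = (d + n - 1).choose n := by
  simp [degreeExponents, Finset.card_finsuppAntidiag_nat_eq_choose]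

theorem isHomogeneous_iff_mem_restrictSupport {n : ℕ} {f : MvPolynomial (Fin d) K} :
    f.IsHomogeneous n ↔ f ∈ restrictSupport K (degreeExponents d n : Set (Fin d →₀ ℕ)) := by
  rw [mem_restrictSupport_iff]
  constructor
  · intro h α hα
    rw [Finset.mem_coe, mem_degreeExponents, Finsupp.degree_eq_weight_one]
    exact h (mem_support_iff.1 hα)
  · intro h α hα
    have := h (mem_support_iff.2 hα)
    rw [Finset.mem_coe, mem_degreeExponents, Finsupp.degree_eq_weight_one] at this
    exact this

theorem finrank_restrictSupport (T : Finset (Fin d →₀ ℕ)) :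
    Module.finrank K (restrictSupport K (T : Set (Fin d →₀ ℕ))) = T.card := by
  rw [Module.finrank_eq_card_basis (basisRestrictSupport K (T : Set (Fin d →₀ ℕ)))]
  simp

instance finite_restrictSupport (T : Finset (Fin d →₀ ℕ)) :
    Module.Finite K (restrictSupport K (T : Set (Fin d →₀ ℕ))) :=
  Module.Finite.of_basis (basisRestrictSupport K (T : Set (Fin d →₀ ℕ)))

/-- Evaluation of the polynomials supported on `T` at a family of points. -/
noncomputable def evalFamily {ι : Type*} (T : Set (Fin d →₀ ℕ)) (v : ι → Fin d → K) :
    restrictSupport K T →ₗ[K] ι → K :=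
  LinearMap.pi fun x => ((aeval (v x)).toLinearMap : MvPolynomial (Fin d) K →ₗ[K] K).comp
    (restrictSupport K T).subtype

@[simp] theorem evalFamily_apply {ι : Type*} (T : Set (Fin d →₀ ℕ)) (v : ι → Fin d → K)
    (f : restrictSupport K T) (x : ι) :
    evalFamily T v f x = eval (v x) (f : MvPolynomial (Fin d) K) := by
  simp [evalFamily, aeval_eq_eval]

/-- Dual functions make evaluation surjective, and equal dimensions then make it injective; `f` and
its interpolant have the same values. -/
theorem eq_sum_eval_smul_of_dual {ι : Type*} [Fintype ι] [DecidableEq ι]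
    {T : Finset (Fin d →₀ ℕ)}
    (hcard : Fintype.card ι = T.card) (v : ι → Fin d → K) (F : ι → MvPolynomial (Fin d) K)
    (hF : ∀ x, F x ∈ restrictSupport K (T : Set (Fin d →₀ ℕ)))
    (hdual : ∀ x y, eval (v y) (F x) = if x = y then 1 else 0)
    {f : MvPolynomial (Fin d) K} (hf : f ∈ restrictSupport K (T : Set (Fin d →₀ ℕ))) :
    f = ∑ x, eval (v x) f • F x := by
  have key : ∀ g : ι → K, ∀ y, eval (v y) (∑ x, g x • F x) = g y := by
    intro g y
    simp [map_sum, smul_eval, hdual]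
  have hmem : ∀ g : ι → K, ∑ x, g x • F x ∈ restrictSupport K (T : Set (Fin d →₀ ℕ)) :=
    fun g => Submodule.sum_mem _ fun x _ => Submodule.smul_mem _ _ (hF x)
  have hsurj : Function.Surjective (evalFamily (T : Set (Fin d →₀ ℕ)) v) := by
    intro g
    refine ⟨⟨∑ x, g x • F x, hmem g⟩, ?_⟩
    ext y
    simpa using key g y
  have hinj := (LinearMap.injective_iff_surjective_of_finrank_eq_finrank
    (by rw [finrank_restrictSupport, Module.finrank_fintype_fun_eq_card, hcard])).2 hsurj
  have := @hinj ⟨f, hf⟩ ⟨∑ x, eval (v x) f • F x, hmem _⟩ (by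
    ext y
    simp only [evalFamily_apply]
    exact (key (fun x => eval (v x) f) y).symm)
  exact congrArg Subtype.val this

/-- By the multinomial theorem, `Λ` of `(a,ξ)^n` is a polynomial in `a` whose coefficients are
`Λ(ξ^α)` times positive multinomials. It vanishes identically, so every coefficient does. -/
theorem map_eq_zero_of_linForm_pow {n : ℕ} (Λ : MvPolynomial (Fin d) ℝ →ₗ[ℝ] ℝ)
    (h : ∀ a : Fin d → ℝ, Λ (linForm a ^ n) = 0) {f : MvPolynomial (Fin d) ℝ}
    (hf : f.IsHomogeneous n) : Λ f = 0 := by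
  have hmon : ∀ α ∈ degreeExponents d n, Λ (monomial α 1) = 0 := by
    let Q : MvPolynomial (Fin d) ℝ :=
      ∑ α ∈ degreeExponents d n, monomial α ((α.multinomial : ℝ) * Λ (monomial α 1))
    have hQ : Q = 0 := by
      refine MvPolynomial.funext fun a => ?_
      rw [map_zero, ← h a]
      have hlin : linForm a ^ n = ∑ α ∈ degreeExponents d n,
          monomial α ((α.multinomial : ℝ) * α.prod fun r m => a r ^ m) := by
        ext β
        have := coeff_linearCombination_X_pow_of_fintype a β n
        simp only [smul_eq_C_mul] at this
        rw [linForm, this, coeff_sum]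
        simp only [coeff_monomial, Finset.sum_ite_eq', mem_degreeExponents]
        rfl
      rw [hlin, map_sum, map_sum]
      refine Finset.sum_congr rfl fun α _ => ?_
      rw [eval_monomial, ← mul_one ((α.multinomial : ℝ) * α.prod fun r m => a r ^ m),
        ← smul_eq_mul _ (1 : ℝ), ← smul_monomial, map_smul, smul_eq_mul]
      ring
    intro α hα
    have h1 : coeff α Q = (α.multinomial : ℝ) * Λ (monomial α 1) := by
      simp [Q, coeff_sum, coeff_monomial, hα]
    rw [hQ, coeff_zero] at h1
    have h2 : (α.multinomial : ℝ) ≠ 0 := by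
      have : 0 < α.multinomial := Nat.multinomial_pos _ _
      positivity
    simpa [h2] using h1.symm
  rw [← support_sum_monomial_coeff f, map_sum]
  refine Finset.sum_eq_zero fun α hα => ?_
  have := isHomogeneous_iff_mem_restrictSupport.1 hf
  have h1 : α ∈ degreeExponents d n := (mem_restrictSupport_iff _).1 this hα
  rw [← mul_one (coeff α f), ← smul_eq_mul, ← smul_monomial, map_smul, hmon α h1, smul_zero]

/-- Multiplying by `|ξ|²`, which `Λ` does not see, raises the degree from `n` to `m` in steps of
two. -/
theorem map_eq_zero_of_normSqPoly_invariant (Λ : MvPolynomial (Fin d) ℝ →ₗ[ℝ] ℝ)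
    (hinv : ∀ f, Λ (normSqPoly d ℝ * f) = Λ f) {m : ℕ}
    (h : ∀ f : MvPolynomial (Fin d) ℝ, f.IsHomogeneous m → Λ f = 0) (s n : ℕ)
    (hsn : n + 2 * s = m) (f : MvPolynomial (Fin d) ℝ) (hf : f.IsHomogeneous n) : Λ f = 0 := by
  induction s generalizing n f with
  | zero => exact h f (by simpa [← hsn] using hf)
  | succ s ih =>
    rw [← hinv f]
    refine ih (2 + n) (by omega) _ (normSqPoly_isHomogeneous.mul hf)

/-- The homogenization of `P ((a, ξ))` by powers of `|ξ|²`, up to parity, in degree `n`. -/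
noncomputable def zonal (n : ℕ) (a : Fin d → K) (P : K[X]) : MvPolynomial (Fin d) K :=
  ∑ j ∈ Finset.range (n + 1), P.coeff j • (normSqPoly d K ^ ((n - j) / 2) * linForm a ^ j)

theorem eval_zonal {n : ℕ} (a : Fin d → K) {P : K[X]} (hP : P.natDegree ≤ n) {v : Fin d → K}
    (hv : v ⬝ᵥ v = 1) : eval v (zonal n a P) = P.eval (a ⬝ᵥ v) := by
  rw [zonal, map_sum, Polynomial.eval_eq_sum_range' (Nat.lt_succ_of_le hP)]
  simp [smul_eval, eval_normSqPoly, hv, eval_linForm]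

theorem zonal_term_isHomogeneous (n j : ℕ) (a : Fin d → K) :
    (normSqPoly d K ^ ((n - j) / 2) * linForm a ^ j).IsHomogeneous (2 * ((n - j) / 2) + j) := by
  simpa using (normSqPoly_isHomogeneous.pow ((n - j) / 2)).mul ((linForm_isHomogeneous a).pow j)

theorem zonal_mem_restrictSupport {n : ℕ} (hn : 1 ≤ n) (a : Fin d → K) (P : K[X]) :
    zonal n a P ∈ restrictSupport K
      ((degreeExponents d n ∪ degreeExponents d (n - 1) : Finset _) : Set (Fin d →₀ ℕ)) := by
  refine Submodule.sum_mem _ fun j hj => Submodule.smul_mem _ _ ?_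
  have hj' : j ≤ n := Nat.lt_succ_iff.1 (Finset.mem_range.1 hj)
  have hh := zonal_term_isHomogeneous n j a
  -- When `n - j` is odd, the halved exponent is rounded down and the term lands in degree `n - 1`.
  rcases Nat.even_or_odd (n - j) with ⟨c, hc⟩ | ⟨c, hc⟩
  · rw [show 2 * ((n - j) / 2) + j = n by omega, isHomogeneous_iff_mem_restrictSupport] at hh
    exact restrictSupport_mono K (by simp) hh
  · rw [show 2 * ((n - j) / 2) + j = n - 1 by omega, isHomogeneous_iff_mem_restrictSupport] at hh
    exact restrictSupport_mono K (by simp) hh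

theorem zonal_isHomogeneous {n : ℕ} (a : Fin d → K) (P : K[X])
    (hP : ∀ j ≤ n, P.coeff j ≠ 0 → Even (n - j)) : (zonal n a P).IsHomogeneous n := by
  rw [isHomogeneous_iff_mem_restrictSupport]
  refine Submodule.sum_mem _ fun j hj => ?_
  have hj' : j ≤ n := Nat.lt_succ_iff.1 (Finset.mem_range.1 hj)
  by_cases h0 : P.coeff j = 0
  · simp [h0]
  · obtain ⟨c, hc⟩ := hP j hj' h0
    have hh := zonal_term_isHomogeneous n j a
    rw [show 2 * ((n - j) / 2) + j = n by omega, isHomogeneous_iff_mem_restrictSupport] at hh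
    exact Submodule.smul_mem _ _ hh

end Homogeneous

theorem natCast_add_natCast_sub_one_ne_zero {K : Type*} [Field K] [CharZero K] {d : ℕ} (hd : 2 ≤ d) (j : ℕ) :
    (d : K) + j - 1 ≠ 0 := by
  have : (d : K) + j - 1 = ((d + j - 1 : ℕ) : K) := by
    push_cast [show 1 ≤ d + j by omega]
    ring
  rw [this, Nat.cast_ne_zero]
  omega

/-! ### Moments against powers of isotropic forms. -/

section Isotropic

open MvPolynomial

variable {d : ℕ} {K : Type*} [Field K] [Algebra ℝ K]

theorem momentMap_zonal_mul (n : ℕ) (a : Fin d → K) (P : K[X]) (f : MvPolynomial (Fin d) K) :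
    momentMap K (zonal n a P * f) =
      ∑ j ∈ Finset.range (n + 1), P.coeff j * momentMap K (linForm a ^ j * f) := by
  simp only [zonal, Finset.sum_mul, map_sum, smul_mul_assoc, map_smul, smul_eq_mul, mul_assoc,
    momentMap_normSqPoly_pow_mul]

theorem momentMap_linForm_pow_of_isotropic [CharZero K] (hd : 2 ≤ d) {u : Fin d → K}
    (hu : u ⬝ᵥ u = 0) {n : ℕ} (hn : n ≠ 0) : momentMap K (linForm u ^ n) = 0 := by
  obtain ⟨m, rfl⟩ := Nat.exists_eq_succ_of_ne_zero hn
  have h := momentMap_linForm_pow_succ_mul (K := K) (by omega) u u m 0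
  simpa [hu, natCast_add_natCast_sub_one_ne_zero hd m] using h

/-- A power of an isotropic form is harmonic, hence orthogonal to lower degrees. In the recursion
the two remaining terms have exponents `(j - 1, n)` and `(j, n - 1)`, both covered by induction. -/
theorem momentMap_linForm_pow_mul_isotropic_pow_eq_zero [CharZero K] (hd : 2 ≤ d) (a : Fin d → K)
    {u : Fin d → K} (hu : u ⬝ᵥ u = 0) (j n : ℕ) (hjn : j < n) :
    momentMap K (linForm a ^ j * linForm u ^ n) = 0 := by
  induction j using Nat.strong_induction_on generalizing n with
  | _ j ih =>
    rcases j with _ | j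
    · rw [pow_zero, one_mul]
      exact momentMap_linForm_pow_of_isotropic hd hu (by omega)
    · have h := momentMap_linForm_pow_succ_mul (K := K) (by omega) a u j n
      rw [ih (j - 1) (by omega) n (by omega), ih j (by omega) (n - 1) (by omega)] at h
      have h2 := natCast_add_natCast_sub_one_ne_zero (K := K) hd (j + n)
      rw [Nat.cast_add, ← add_assoc] at h2
      simpa [h2] using h

/-- One term of the recursion survives. Passing from `n` to `n + 1` contributes `(n + 1) / (d +
2n)`, which is `λ_{n+1}`. -/
theorem momentMap_linForm_pow_mul_isotropic_pow [CharZero K] (hd : 2 ≤ d) (a : Fin d → K)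
    {u : Fin d → K} (hu : u ⬝ᵥ u = 0) (n : ℕ) :
    momentMap K (linForm a ^ n * linForm u ^ n) =
      algebraMap ℝ K (∏ l ∈ Finset.range n, gegenbauerLambda d (l + 1)) * (a ⬝ᵥ u) ^ n := by
  induction n with
  | zero =>
    have h := momentMap_map K (1 : MvPolynomial (Fin d) ℝ)
    rw [map_one, sphereMean_one (by omega)] at h
    simpa using h
  | succ n ih =>
    have h := momentMap_linForm_pow_succ_mul (K := K) (by omega) a u n (n + 1)
    rw [momentMap_linForm_pow_mul_isotropic_pow_eq_zero hd a hu (n - 1) (n + 1) (by omega),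
      Nat.add_sub_cancel, ih, mul_zero, zero_add] at h
    have h2 := natCast_add_natCast_sub_one_ne_zero (K := K) hd (n + (n + 1))
    have h3 : algebraMap ℝ K (gegenbauerLambda d (n + 1)) * ((d : K) + n + (n + 1 : ℕ) - 1) =
        (n + 1 : ℕ) := by
      have : gegenbauerLambda d (n + 1) * ((d : ℝ) + n + (n + 1 : ℕ) - 1) = (n + 1 : ℕ) := by
        rw [gegenbauerLambda, show (d : ℝ) + 2 * (n + 1 : ℕ) - 2 = (d : ℝ) + n + (n + 1 : ℕ) - 1 by
          push_cast; ring, div_mul_cancel₀]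
        have := natCast_add_natCast_sub_one_ne_zero (K := ℝ) hd (n + (n + 1))
        rwa [Nat.cast_add, ← add_assoc] at this
      simpa using congrArg (algebraMap ℝ K) this
    rw [Nat.cast_add n, ← add_assoc] at h2
    apply mul_left_cancel₀ h2
    rw [h, Finset.prod_range_succ, map_mul]
    linear_combination (-(algebraMap ℝ K (∏ l ∈ Finset.range n, gegenbauerLambda d (l + 1)) *
      (a ⬝ᵥ u) ^ (n + 1))) * h3

theorem momentMap_zonal_mul_isotropic_pow [CharZero K] (hd : 2 ≤ d) (n : ℕ) (a : Fin d → K)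
    (P : K[X]) {u : Fin d → K} (hu : u ⬝ᵥ u = 0) :
    momentMap K (zonal n a P * linForm u ^ n) =
      P.coeff n * (algebraMap ℝ K (∏ l ∈ Finset.range n, gegenbauerLambda d (l + 1)) *
        (a ⬝ᵥ u) ^ n) := by
  rw [momentMap_zonal_mul, Finset.sum_range_succ,
    momentMap_linForm_pow_mul_isotropic_pow hd a hu, Finset.sum_eq_zero, zero_add]
  intro j hj
  rw [momentMap_linForm_pow_mul_isotropic_pow_eq_zero hd a hu j n (Finset.mem_range.1 hj),
    mul_zero]

end Isotropic

/-! ### Leading coefficients of Gegenbauer polynomials and existence of expansions. -/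

section Gegenbauer

theorem gegenbauerLambda_succ_pos {d : ℕ} (hd : 2 ≤ d) (l : ℕ) :
    0 < gegenbauerLambda d (l + 1) := by
  rw [gegenbauerLambda]
  have : (2 : ℝ) ≤ d := by exact_mod_cast hd
  have h0 : (0 : ℝ) ≤ l := l.cast_nonneg
  push_cast
  apply div_pos <;> linarith

theorem gegenbauerG_natDegree_le (d n : ℕ) : (gegenbauerG d n).natDegree ≤ n := by
  induction n using Nat.strong_induction_on with
  | _ n ih =>
    match n with
    | 0 => simp [gegenbauerG]
    | 1 =>
      rw [gegenbauerG]
      exact (Polynomial.natDegree_C_mul_le _ _).trans Polynomial.natDegree_X_le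
    | n + 2 =>
      rw [gegenbauerG]
      refine (Polynomial.natDegree_C_mul_le _ _).trans ((Polynomial.natDegree_sub_le _ _).trans
        (max_le ?_ ?_))
      · refine Polynomial.natDegree_mul_le.trans ?_
        have := ih (n + 1) (by omega)
        have := Polynomial.natDegree_X_le (R := ℝ)
        omega
      · refine (Polynomial.natDegree_C_mul_le _ _).trans ((ih n (by omega)).trans (by omega))

theorem gegenbauerG_coeff_self {d : ℕ} (n : ℕ) :
    (gegenbauerG d n).coeff n = (∏ l ∈ Finset.range n, gegenbauerLambda d (l + 1))⁻¹ := by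
  induction n using Nat.strong_induction_on with
  | _ n ih =>
    match n with
    | 0 => simp [gegenbauerG]
    | 1 => simp [gegenbauerG, gegenbauerLambda]
    | n + 2 =>
      have h1 : (gegenbauerG d n).coeff (n + 2) = 0 :=
        Polynomial.coeff_eq_zero_of_natDegree_lt
          ((gegenbauerG_natDegree_le d n).trans_lt (by omega))
      rw [gegenbauerG, Polynomial.coeff_C_mul, Polynomial.coeff_sub, Polynomial.coeff_C_mul, h1,
        Polynomial.coeff_X_mul, ih (n + 1) (by omega), Finset.prod_range_succ _ (n + 1), mul_zero,
        sub_zero, mul_inv_rev]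

/-- Only `G_n` reaches degree `n`. Its leading coefficient is the inverse of the constant in the
isotropic moments, which is why the top Gegenbauer coefficient serves as the weight. -/
theorem IsGegenbauerExpansion.coeff_eq {d n : ℕ} {P : ℝ[X]} {f : ℕ → ℝ}
    (h : IsGegenbauerExpansion d n P f) :
    P.coeff n = f n * (∏ l ∈ Finset.range n, gegenbauerLambda d (l + 1))⁻¹ := by
  have h' : P = ∑ i ∈ Finset.range (n + 1), Polynomial.C (f i) * gegenbauerG d i := h
  rw [h', Polynomial.finsetSum_coeff, Finset.sum_range_succ, Finset.sum_eq_zero, zero_add,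
    Polynomial.coeff_C_mul, gegenbauerG_coeff_self]
  intro i hi
  rw [Polynomial.coeff_C_mul, Polynomial.coeff_eq_zero_of_natDegree_lt
    ((gegenbauerG_natDegree_le d i).trans_lt (Finset.mem_range.1 hi)), mul_zero]

theorem exists_isGegenbauerExpansion {d : ℕ} (hd : 2 ≤ d) (n : ℕ) (P : ℝ[X])
    (hP : P.natDegree ≤ n) : ∃ f, IsGegenbauerExpansion d n P f := by
  induction n generalizing P with
  | zero =>
    refine ⟨fun _ => P.coeff 0, ?_⟩
    rw [IsGegenbauerExpansion]
    simpa [gegenbauerG] using Polynomial.eq_C_of_natDegree_le_zero hP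
  | succ n ih =>
    set g := ∏ l ∈ Finset.range (n + 1), gegenbauerLambda d (l + 1) with hg
    have hg0 : g ≠ 0 := Finset.prod_ne_zero_iff.2 fun l _ => (gegenbauerLambda_succ_pos hd l).ne'
    have hc : (gegenbauerG d (n + 1)).coeff (n + 1) = g⁻¹ := gegenbauerG_coeff_self _
    obtain ⟨f, hf⟩ := ih (P - Polynomial.C (P.coeff (n + 1) * g) * gegenbauerG d (n + 1)) (by
      refine Polynomial.natDegree_le_iff_coeff_eq_zero.2 fun m hm => ?_
      rcases (Nat.succ_le_of_lt hm).eq_or_lt with rfl | hm'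
      · rw [Polynomial.coeff_sub, Polynomial.coeff_C_mul, hc, mul_assoc, mul_inv_cancel₀ hg0]
        simp
      · rw [Polynomial.coeff_sub, Polynomial.coeff_C_mul,
          Polynomial.coeff_eq_zero_of_natDegree_lt (hP.trans_lt hm'),
          Polynomial.coeff_eq_zero_of_natDegree_lt
            ((gegenbauerG_natDegree_le d _).trans_lt hm')]
        simp)
    refine ⟨Function.update f (n + 1) (P.coeff (n + 1) * g), ?_⟩
    have hf' : P - Polynomial.C (P.coeff (n + 1) * g) * gegenbauerG d (n + 1) =
      ∑ i ∈ Finset.range (n + 1), Polynomial.C (f i) * gegenbauerG d i := hf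
    rw [IsGegenbauerExpansion, Finset.sum_range_succ, Function.update_self, ← sub_eq_iff_eq_add,
      hf']
    refine Finset.sum_congr rfl fun i hi => ?_
    rw [Function.update_of_ne (Finset.mem_range.1 hi).ne]

end Gegenbauer

/-! ### Cubature formulas from dual annihilators. -/

section Forward

open MvPolynomial

variable {d : ℕ}

theorem dotProduct_eq_inner (x y : EuclideanSpace ℝ (Fin d)) :
    (fun i => x i) ⬝ᵥ (fun i => y i) = inner ℝ x y := by
  simp [dotProduct, PiLp.inner_apply, mul_comm]

theorem dotProduct_self_of_norm_eq_one {x : EuclideanSpace ℝ (Fin d)} (hx : ‖x‖ = 1) :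
    (fun i => x i) ⬝ᵥ (fun i => x i) = 1 := by
  rw [dotProduct_eq_inner, real_inner_self_eq_norm_sq, hx, one_pow]

/-- Since `d ≥ 2`, the kernel of `(a,·)` contains a nonzero vector, which is then rescaled. -/
theorem exists_orthogonal_same_norm (hd : 2 ≤ d) (a : Fin d → ℝ) :
    ∃ b : Fin d → ℝ, b ⬝ᵥ b = a ⬝ᵥ a ∧ a ⬝ᵥ b = 0 := by
  have hker : LinearMap.ker (dotProductBilin ℝ ℝ a) ≠ ⊥ :=
    LinearMap.ker_ne_bot_of_finrank_lt (by simp; omega)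
  obtain ⟨c, hc, hc0⟩ := Submodule.exists_mem_ne_zero_of_ne_bot hker
  have hac : a ⬝ᵥ c = 0 := by simpa using hc
  have hcc : 0 < c ⬝ᵥ c := by
    refine lt_of_le_of_ne (Finset.sum_nonneg fun i _ => mul_self_nonneg _) (Ne.symm ?_)
    simpa [dotProduct_self_eq_zero] using hc0
  have haa : 0 ≤ a ⬝ᵥ a := Finset.sum_nonneg fun i _ => mul_self_nonneg _
  refine ⟨Real.sqrt (a ⬝ᵥ a / c ⬝ᵥ c) • c, ?_, ?_⟩
  · rw [smul_dotProduct, dotProduct_smul, smul_eq_mul, smul_eq_mul, ← mul_assoc,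
      Real.mul_self_sqrt (by positivity), div_mul_cancel₀ _ hcc.ne']
  · rw [dotProduct_smul, hac, smul_zero]

theorem linForm_add {K : Type*} [Field K] (a b : Fin d → K) :
    linForm (a + b) = linForm a + linForm b := by
  simp [linForm, add_mul, Finset.sum_add_distrib]

theorem linForm_smul {K : Type*} [Field K] (c : K) (a : Fin d → K) :
    linForm (c • a) = c • linForm a := by
  simp [linForm, smul_eq_C_mul, Finset.mul_sum, mul_assoc]

/-- A functional killing all multiples of `n`-th powers of isotropic forms kills the high powers
of real forms. -/
theorem map_linForm_pow_eq_zero_of_isotropic (hd : 2 ≤ d) {n m : ℕ} (hnm : n ≤ m)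
    (hnm' : 2 * n ≤ m + 1) (Λ : MvPolynomial (Fin d) ℂ →ₗ[ℂ] ℂ)
    (h : ∀ u : Fin d → ℂ, u ⬝ᵥ u = 0 → ∀ f : MvPolynomial (Fin d) ℂ, f.IsHomogeneous (m - n) →
      Λ (f * linForm u ^ n) = 0) (a : Fin d → ℝ) :
    Λ (linForm (fun i => (a i : ℂ)) ^ m) = 0 := by
  obtain ⟨b, hb, hab⟩ := exists_orthogonal_same_norm hd a
  set a' : Fin d → ℂ := fun i => (a i : ℂ)
  set b' : Fin d → ℂ := fun i => (b i : ℂ)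
  have hdot : ∀ p q : Fin d → ℝ, (fun i => (p i : ℂ)) ⬝ᵥ (fun i => (q i : ℂ)) =
      ((p ⬝ᵥ q : ℝ) : ℂ) := fun p q => by simp [dotProduct]
  have haa : a' ⬝ᵥ a' = ((a ⬝ᵥ a : ℝ) : ℂ) := hdot a a
  have hbb : b' ⬝ᵥ b' = ((a ⬝ᵥ a : ℝ) : ℂ) := by rw [← hb]; exact hdot b b
  have hab' : a' ⬝ᵥ b' = 0 := by simpa [hab] using hdot a b
  have hba' : b' ⬝ᵥ a' = 0 := by rw [dotProduct_comm, hab']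
  have hiso : ∀ c : ℂ, c * c = -1 → (a' + c • b') ⬝ᵥ (a' + c • b') = 0 := by
    intro c hc
    simp only [add_dotProduct, dotProduct_add, smul_dotProduct, dotProduct_smul, smul_eq_mul, haa,
      hbb, hab', hba']
    linear_combination ((a ⬝ᵥ a : ℝ) : ℂ) * hc
  -- The vectors `a ± ib` are isotropic because `a` and `b` are orthogonal of equal length, and they
  -- add up to `2a`.
  set u := a' + Complex.I • b'
  set v := a' + (-Complex.I) • b'
  have hu : u ⬝ᵥ u = 0 := hiso _ Complex.I_mul_I
  have hv : v ⬝ᵥ v = 0 := hiso _ (by rw [neg_mul_neg, Complex.I_mul_I])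
  have huv : u + v = (2 : ℂ) • a' := by
    ext i
    simp [u, v]
    ring
  have hpow : (2 : ℂ) ^ m • linForm a' ^ m = (linForm u + linForm v) ^ m := by
    rw [← linForm_add, huv, linForm_smul, smul_pow]
  have hzero : Λ ((2 : ℂ) ^ m • linForm a' ^ m) = 0 := by
    rw [hpow, add_pow, map_sum]
    refine Finset.sum_eq_zero fun j hj => ?_
    have hj' : j ≤ m := Nat.lt_succ_iff.1 (Finset.mem_range.1 hj)
    have hc : linForm u ^ j * linForm v ^ (m - j) * ((m.choose j : ℕ) : MvPolynomial (Fin d) ℂ) =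
        (m.choose j : ℂ) • (linForm u ^ j * linForm v ^ (m - j)) := by
      rw [smul_eq_C_mul, map_natCast, mul_comm]
    rw [hc, map_smul, smul_eq_zero]
    right
    -- In each binomial term one exponent is at least `n`: if `j < n`, then `m - j ≥ n` because `2n
    -- ≤ m + 1`.
    rcases le_or_gt n j with hnj | hnj
    · have hhom : (linForm u ^ (j - n) * linForm v ^ (m - j)).IsHomogeneous (m - n) := by
        have := ((linForm_isHomogeneous u).pow (j - n)).mul
          ((linForm_isHomogeneous v).pow (m - j))
        rwa [one_mul, one_mul, show j - n + (m - j) = m - n by omega] at this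
      rw [← h u hu _ hhom, mul_right_comm, ← pow_add, Nat.sub_add_cancel hnj]
    · have hhom : (linForm u ^ j * linForm v ^ (m - j - n)).IsHomogeneous (m - n) := by
        have := ((linForm_isHomogeneous u).pow j).mul
          ((linForm_isHomogeneous v).pow (m - j - n))
        rwa [one_mul, one_mul, show j + (m - j - n) = m - n by omega] at this
      rw [← h v hv _ hhom, mul_assoc, ← pow_add, Nat.sub_add_cancel (by omega)]
  rw [map_smul, smul_eq_zero] at hzero
  exact hzero.resolve_left (pow_ne_zero _ two_ne_zero)

theorem eval_map_ofReal (x : Fin d → ℝ) (f : MvPolynomial (Fin d) ℝ) :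
    eval (fun i => (x i : ℂ)) (map (algebraMap ℝ ℂ) f) = ((eval x f : ℝ) : ℂ) := by
  have := eval₂_comp_left (algebraMap ℝ ℂ) (RingHom.id ℝ) x f
  rw [eval_map]
  exact this.symm

/-- Annihilators dual to `Y` make `Y` a cubature formula in degree `m`. -/
theorem sphereMean_eq_sum_of_annihilators (hd : 2 ≤ d) {n m : ℕ} (hnm : n ≤ m)
    (hnm' : 2 * n ≤ m + 1) (Y : Finset (EuclideanSpace ℝ (Fin d))) (hY : ∀ x ∈ Y, ‖x‖ = 1)
    (T : Finset (Fin d →₀ ℕ)) (hcard : Y.card = T.card) (hT : degreeExponents d (m - n) ⊆ T)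
    (P : EuclideanSpace ℝ (Fin d) → ℝ[X]) (hdeg : ∀ x ∈ Y, (P x).natDegree ≤ n)
    (hmem : ∀ x ∈ Y, zonal n (fun i => (x i : ℂ)) ((P x).map (algebraMap ℝ ℂ)) ∈
      restrictSupport ℂ (T : Set (Fin d →₀ ℕ)))
    (hself : ∀ x ∈ Y, (P x).eval 1 = 1)
    (hne : ∀ x ∈ Y, ∀ y ∈ Y, x ≠ y → (P x).eval (inner ℝ x y) = 0)
    {f : MvPolynomial (Fin d) ℝ} (hf : f.IsHomogeneous m) :
    sphereMean f = ∑ x ∈ Y, ((P x).coeff n *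
      ∏ l ∈ Finset.range n, gegenbauerLambda d (l + 1)) * eval (fun i => x i) f := by
  classical
  set w : EuclideanSpace ℝ (Fin d) → ℝ := fun x => (P x).coeff n *
      ∏ l ∈ Finset.range n, gegenbauerLambda d (l + 1) with hw
  let Λr : MvPolynomial (Fin d) ℝ →ₗ[ℝ] ℝ := sphereMeanLinear d -
    ∑ x ∈ Y, w x • (aeval (fun i => x i) : MvPolynomial (Fin d) ℝ →ₐ[ℝ] ℝ).toLinearMap
  let Λ : MvPolynomial (Fin d) ℂ →ₗ[ℂ] ℂ := momentMap ℂ -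
    ∑ x ∈ Y, (w x : ℂ) •
      (aeval (fun i => (x i : ℂ)) : MvPolynomial (Fin d) ℂ →ₐ[ℂ] ℂ).toLinearMap
  have hΛr : ∀ g, Λr g = sphereMean g - ∑ x ∈ Y, w x * eval (fun i => x i) g := fun g => by
    simp [Λr, aeval_eq_eval]
  have hΛ : ∀ g, Λ g = momentMap ℂ g - ∑ x ∈ Y, (w x : ℂ) * eval (fun i => (x i : ℂ)) g :=
    fun g => by simp [Λ, aeval_eq_eval]
  have hΛmap : ∀ g, Λ (map (algebraMap ℝ ℂ) g) = ((Λr g : ℝ) : ℂ) := fun g => by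
    simp only [hΛ, hΛr, momentMap_map, eval_map_ofReal]
    simp
  have hdot : ∀ x y : EuclideanSpace ℝ (Fin d),
      (fun i => (x i : ℂ)) ⬝ᵥ (fun i => (y i : ℂ)) = ((inner ℝ x y : ℝ) : ℂ) := fun x y => by
    rw [← dotProduct_eq_inner]
    simp [dotProduct]
  have hdual : ∀ x y : Y, eval (fun i => (y.1 i : ℂ))
      (zonal n (fun i => (x.1 i : ℂ)) ((P x).map (algebraMap ℝ ℂ))) =
        if x = y then 1 else 0 := by
    intro x y
    rw [eval_zonal _ ((Polynomial.natDegree_map_le).trans (hdeg x x.2))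
      (by rw [hdot, real_inner_self_eq_norm_sq, hY y y.2]; simp), hdot,
      ← Complex.coe_algebraMap, Polynomial.eval_map_algebraMap, Polynomial.aeval_algebraMap_apply]
    split_ifs with hxy
    · subst hxy
      rw [real_inner_self_eq_norm_sq, hY x x.2, one_pow, Polynomial.coe_aeval_eq_eval,
        hself x x.2, map_one]
    · rw [Polynomial.coe_aeval_eq_eval, hne x x.2 y y.2 (fun h => hxy (Subtype.ext h)), map_zero]
  -- Interpolate `g` by the annihilators. The moment of each one against `(u,ξ)^n` is exactly `w(x)
  -- (x,u)^n`, so the sum is the cubature sum of `g (u,ξ)^n`.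
  have hiso : ∀ u : Fin d → ℂ, u ⬝ᵥ u = 0 → ∀ g : MvPolynomial (Fin d) ℂ,
      g.IsHomogeneous (m - n) → Λ (g * linForm u ^ n) = 0 := by
    intro u hu g hg
    have hgT : g ∈ restrictSupport ℂ (T : Set (Fin d →₀ ℕ)) :=
      restrictSupport_mono ℂ (by exact_mod_cast hT) (isHomogeneous_iff_mem_restrictSupport.1 hg)
    have hg' := eq_sum_eval_smul_of_dual (ι := Y) (by rw [Fintype.card_coe, hcard])
      (fun y i => (y.1 i : ℂ)) (fun x => zonal n (fun i => (x.1 i : ℂ))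
        ((P x).map (algebraMap ℝ ℂ))) (fun x => hmem x x.2) hdual hgT
    rw [hΛ, sub_eq_zero]
    conv_lhs => rw [hg']
    rw [Finset.sum_mul, map_sum, ← Finset.sum_coe_sort Y]
    refine Finset.sum_congr rfl fun x _ => ?_
    rw [smul_mul_assoc, map_smul, momentMap_zonal_mul_isotropic_pow hd n _ _ hu,
      Polynomial.coeff_map, map_mul, map_pow, eval_linForm, dotProduct_comm u, smul_eq_mul, hw]
    simp
    ring
  have hfin := map_eq_zero_of_linForm_pow (n := m) Λr (fun a => by
    have h1 := map_linForm_pow_eq_zero_of_isotropic hd hnm hnm' Λ hiso a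
    have h2 : linForm (fun i => (a i : ℂ)) ^ m = map (algebraMap ℝ ℂ) (linForm a ^ m) := by
      simp [linForm]
    rw [h2, hΛmap] at h1
    exact_mod_cast h1) hf
  rw [hΛr] at hfin
  linarith

/-- Cubature in degree `m` implies cubature in all lower degrees of the same parity. -/
theorem sphereMean_eq_sum_of_lower_degree (Y : Finset (EuclideanSpace ℝ (Fin d)))
    (hY : ∀ x ∈ Y, ‖x‖ = 1) (w : EuclideanSpace ℝ (Fin d) → ℝ) {m n s : ℕ} (hm : n + 2 * s = m)
    (h : ∀ f : MvPolynomial (Fin d) ℝ, f.IsHomogeneous m →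
      sphereMean f = ∑ x ∈ Y, w x * eval (fun i => x i) f)
    {f : MvPolynomial (Fin d) ℝ} (hf : f.IsHomogeneous n) :
    sphereMean f = ∑ x ∈ Y, w x * eval (fun i => x i) f := by
  let Λr : MvPolynomial (Fin d) ℝ →ₗ[ℝ] ℝ := sphereMeanLinear d -
    ∑ x ∈ Y, w x • (aeval (fun i => x i) : MvPolynomial (Fin d) ℝ →ₐ[ℝ] ℝ).toLinearMap
  have hΛr : ∀ g, Λr g = sphereMean g - ∑ x ∈ Y, w x * eval (fun i => x i) g := fun g => by
    simp [Λr, aeval_eq_eval]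
  have h0 := map_eq_zero_of_normSqPoly_invariant Λr (fun g => by
      rw [hΛr, hΛr, sphereMean_normSqPoly_mul]
      congr 1
      refine Finset.sum_congr rfl fun x hx => ?_
      rw [map_mul, eval_normSqPoly, dotProduct_self_of_norm_eq_one (hY x hx), one_mul])
    (fun g hg => by rw [hΛr, h g hg, sub_self]) s n hm f hf
  rw [hΛr] at h0
  linarith

theorem sphereMean_eq_sum_of_isHomogeneous (Y : Finset (EuclideanSpace ℝ (Fin d)))
    (w : EuclideanSpace ℝ (Fin d) → ℝ) {t : ℕ}
    (h : ∀ n ≤ t, ∀ f : MvPolynomial (Fin d) ℝ, f.IsHomogeneous n →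
      sphereMean f = ∑ x ∈ Y, w x * eval (fun i => x i) f)
    {f : MvPolynomial (Fin d) ℝ} (hf : f.totalDegree ≤ t) :
    sphereMean f = ∑ x ∈ Y, w x * eval (fun i => x i) f := by
  rw [← sum_homogeneousComponent f, ← sphereMeanLinear_apply, map_sum]
  simp only [map_sum, Finset.mul_sum]
  rw [Finset.sum_comm]
  refine Finset.sum_congr rfl fun n hn => ?_
  exact h n (by have := Finset.mem_range.1 hn; omega) _ (homogeneousComponent_isHomogeneous n f)

end Forward

/-! ### Vanishing of odd moments. -/

section OddMean

open MvPolynomial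

variable {d : ℕ}

theorem momentMap_linForm_pow_odd (hd : 2 ≤ d) (a : Fin d → ℝ) (n : ℕ) (hn : Odd n) :
    momentMap ℝ (linForm a ^ n) = 0 := by
  induction n using Nat.strong_induction_on with
  | _ n ih =>
    obtain ⟨c, rfl⟩ := hn
    have h := momentMap_linForm_pow_succ_mul (K := ℝ) (by omega) a a (2 * c) 0
    have h2 := natCast_add_natCast_sub_one_ne_zero (K := ℝ) hd (2 * c)
    have h0 : ((2 * c : ℕ) : ℝ) * momentMap ℝ (linForm a ^ (2 * c - 1)) = 0 := by
      rcases Nat.eq_zero_or_pos c with rfl | hc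
      · simp
      · rw [ih (2 * c - 1) (by omega) ⟨c - 1, by omega⟩, mul_zero]
    rw [pow_zero, mul_one, mul_one, mul_right_comm, h0] at h
    simp only [Nat.cast_zero, zero_mul, add_zero] at h
    exact (mul_eq_zero.1 h).resolve_left h2

theorem sphereMean_eq_zero_of_odd (hd : 2 ≤ d) {n : ℕ} (hn : Odd n) {f : MvPolynomial (Fin d) ℝ}
    (hf : f.IsHomogeneous n) : sphereMean f = 0 := by
  rw [← momentMap_real]
  exact map_eq_zero_of_linForm_pow _ (fun a => momentMap_linForm_pow_odd hd a n hn) hf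

theorem eval_smul_of_isHomogeneous {n : ℕ} {f : MvPolynomial (Fin d) ℝ} (hf : f.IsHomogeneous n)
    (c : ℝ) (v : Fin d → ℝ) : eval (c • v) f = c ^ n * eval v f := by
  rw [eval_eq', eval_eq', Finset.mul_sum]
  refine Finset.sum_congr rfl fun α hα => ?_
  have hdeg : ∑ i, α i = n := by
    rw [← Finsupp.degree_eq_sum, Finsupp.degree_eq_weight_one]
    exact hf (mem_support_iff.1 hα)
  simp only [Pi.smul_apply, smul_eq_mul, mul_pow, Finset.prod_mul_distrib,
    Finset.prod_pow_eq_pow_sum, hdeg]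
  ring

end OddMean

/-! ### Locally distance sets of maximal size are designs. -/

section Annihilators

variable {d : ℕ}

theorem norm_eq_one_of_onUnitSphere {X : Finset (EuclideanSpace ℝ (Fin d))} (hX : OnUnitSphere X)
    {x : EuclideanSpace ℝ (Fin d)} (hx : x ∈ X) : ‖x‖ = 1 := by
  simpa using hX x hx

theorem inner_lt_one {x y : EuclideanSpace ℝ (Fin d)} (hx : ‖x‖ = 1) (hy : ‖y‖ = 1)
    (hxy : x ≠ y) : inner ℝ x y < 1 := (inner_lt_one_iff_real_of_norm_eq_one hx hy).2 hxy

theorem inner_eq_of_dist {x y : EuclideanSpace ℝ (Fin d)} (hx : ‖x‖ = 1) (hy : ‖y‖ = 1) :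
    inner ℝ x y = 1 - dist x y ^ 2 / 2 := by
  rw [dist_eq_norm, norm_sub_sq_real, hx, hy]
  ring

theorem dist_eq_of_inner {x y : EuclideanSpace ℝ (Fin d)} (hx : ‖x‖ = 1) (hy : ‖y‖ = 1) :
    dist x y = Real.sqrt (2 - 2 * inner ℝ x y) := by
  rw [inner_eq_of_dist hx hy, show 2 - 2 * (1 - dist x y ^ 2 / 2) = dist x y ^ 2 by ring,
    Real.sqrt_sq dist_nonneg]

theorem card_innerSet_le {X : Finset (EuclideanSpace ℝ (Fin d))} (hX : OnUnitSphere X)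
    {x : EuclideanSpace ℝ (Fin d)} (hx : x ∈ X) :
    (innerSet X x).card ≤ (localDistanceSet X x).card := by
  classical
  have : innerSet X x = (localDistanceSet X x).image fun t => 1 - t ^ 2 / 2 := by
    ext s
    simp only [innerSet, localDistanceSet, Finset.mem_image, Finset.mem_erase,
      exists_exists_and_eq_and]
    refine exists_congr fun y => and_congr_right fun hy => ?_
    rw [inner_eq_of_dist (norm_eq_one_of_onUnitSphere hX hx) (norm_eq_one_of_onUnitSphere hX hy.2)]
  rw [this]
  exact Finset.card_image_le

theorem natDegree_le_and_coeff_X_pow_mul_prod (S : Finset ℝ) (Q : ℝ → ℝ[X]) (q p : ℕ)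
    (hQ : ∀ α ∈ S, (Q α).Monic ∧ (Q α).natDegree = q) :
    (Polynomial.X ^ p * ∏ α ∈ S, (Polynomial.C (1 - α)⁻¹ * Q α)).natDegree ≤ p + q * S.card ∧
    (Polynomial.X ^ p * ∏ α ∈ S, (Polynomial.C (1 - α)⁻¹ * Q α)).coeff (p + q * S.card) =
      ∏ α ∈ S, (1 - α)⁻¹ := by
  have hmon : (Polynomial.X ^ p * ∏ α ∈ S, Q α).Monic :=
    (Polynomial.monic_X_pow p).mul (Polynomial.monic_prod_of_monic _ _ fun α hα => (hQ α hα).1)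
  have hdeg : (Polynomial.X ^ p * ∏ α ∈ S, Q α).natDegree = p + q * S.card := by
    rw [(Polynomial.monic_X_pow p).natDegree_mul
      (Polynomial.monic_prod_of_monic _ _ fun α hα => (hQ α hα).1), Polynomial.natDegree_X_pow,
      Polynomial.natDegree_prod_of_monic _ _ fun α hα => (hQ α hα).1,
      Finset.sum_congr rfl fun α hα => (hQ α hα).2, Finset.sum_const, smul_eq_mul, mul_comm q]
  have heq : Polynomial.X ^ p * ∏ α ∈ S, (Polynomial.C (1 - α)⁻¹ * Q α) =
      Polynomial.C (∏ α ∈ S, (1 - α)⁻¹) * (Polynomial.X ^ p * ∏ α ∈ S, Q α) := by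
    rw [Finset.prod_mul_distrib, map_prod]
    ring
  rw [heq]
  refine ⟨(Polynomial.natDegree_C_mul_le _ _).trans hdeg.le, ?_⟩
  rw [Polynomial.coeff_C_mul, ← hdeg, hmon.coeff_natDegree, mul_one]

theorem annihilator_natDegree_le_and_coeff {k : ℕ} {X : Finset (EuclideanSpace ℝ (Fin d))}
    {x : EuclideanSpace ℝ (Fin d)} (hk : (innerSet X x).card ≤ k) :
    (annihilator k X x).natDegree ≤ k ∧
      (annihilator k X x).coeff k = ∏ α ∈ innerSet X x, (1 - α)⁻¹ := by
  have := natDegree_le_and_coeff_X_pow_mul_prod (innerSet X x) (fun α => Polynomial.X - Polynomial.C α) 1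
    (k - (innerSet X x).card)
    fun α _ => ⟨Polynomial.monic_X_sub_C α, Polynomial.natDegree_X_sub_C α⟩
  rwa [one_mul, Nat.sub_add_cancel hk] at this

theorem lt_one_of_mem_innerSet {X : Finset (EuclideanSpace ℝ (Fin d))} (hX : OnUnitSphere X)
    {x : EuclideanSpace ℝ (Fin d)} (hx : x ∈ X) {α : ℝ} (hα : α ∈ innerSet X x) : α < 1 := by
  classical
  simp only [innerSet, Finset.mem_image, Finset.mem_erase] at hα
  obtain ⟨y, ⟨hyx, hy⟩, rfl⟩ := hα
  exact inner_lt_one (norm_eq_one_of_onUnitSphere hX hx) (norm_eq_one_of_onUnitSphere hX hy)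
    hyx.symm

theorem annihilator_eval_one {k : ℕ} {X : Finset (EuclideanSpace ℝ (Fin d))}
    (hX : OnUnitSphere X) {x : EuclideanSpace ℝ (Fin d)} (hx : x ∈ X) :
    (annihilator k X x).eval 1 = 1 := by
  simp only [annihilator, Polynomial.eval_mul, Polynomial.eval_pow, Polynomial.eval_X, one_pow,
    one_mul, Polynomial.eval_prod, Polynomial.eval_C, Polynomial.eval_sub]
  refine Finset.prod_eq_one fun α hα => inv_mul_cancel₀ ?_
  have := lt_one_of_mem_innerSet hX hx hα
  linarith

theorem annihilator_eval_inner {k : ℕ} {X : Finset (EuclideanSpace ℝ (Fin d))}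
    {x y : EuclideanSpace ℝ (Fin d)} (hy : y ∈ X) (hxy : x ≠ y) :
    (annihilator k X x).eval (inner ℝ x y) = 0 := by
  classical
  simp only [annihilator, Polynomial.eval_mul, Polynomial.eval_prod]
  apply mul_eq_zero_of_right
  refine Finset.prod_eq_zero (i := inner ℝ x y) ?_ (by simp)
  exact Finset.mem_image_of_mem _ (Finset.mem_erase.2 ⟨hxy.symm, hy⟩)

/-- The design obtained from a locally `k`-distance set attaining the upper bound. -/
theorem isTightDesign_of_locallyKDistance {k : ℕ} (hd : 2 ≤ d) (hk : 1 ≤ k)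
    {X : Finset (EuclideanSpace ℝ (Fin d))} (hX : OnUnitSphere X)
    (hloc : IsLocallyKDistanceSet k X) (hcard : X.card = fisherN d k) :
    ∃ f : EuclideanSpace ℝ (Fin d) → ℕ → ℝ,
      (∀ x ∈ X, IsGegenbauerExpansion d k (annihilator k X x) (f x)) ∧
      IsTightWeightedSphericalDesign X (fun x => f x k) (2 * k) := by
  have hle : ∀ x ∈ X, (innerSet X x).card ≤ k := fun x hx =>
    (card_innerSet_le hX hx).trans (hloc x hx)
  have hdeg := fun x hx => (annihilator_natDegree_le_and_coeff (hle x hx)).1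
  have hcoe := fun x hx => (annihilator_natDegree_le_and_coeff (hle x hx)).2
  have hex : ∀ x : EuclideanSpace ℝ (Fin d), ∃ f : ℕ → ℝ,
      x ∈ X → IsGegenbauerExpansion d k (annihilator k X x) f := fun x => by
    by_cases hx : x ∈ X
    · obtain ⟨f, hf⟩ := exists_isGegenbauerExpansion hd k _ (hdeg x hx)
      exact ⟨f, fun _ => hf⟩
    · exact ⟨0, fun h => absurd h hx⟩
  choose f hf using hex
  set g := ∏ l ∈ Finset.range k, gegenbauerLambda d (l + 1) with hg
  have hgpos : 0 < g := Finset.prod_pos fun l _ => gegenbauerLambda_succ_pos hd l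
  have hw : ∀ x ∈ X, f x k = (annihilator k X x).coeff k * g := fun x hx => by
    rw [(hf x hx).coeff_eq, inv_mul_cancel_right₀ hgpos.ne']
  have hmain : ∀ p : MvPolynomial (Fin d) ℝ, p.totalDegree ≤ 2 * k →
      sphereMean p = ∑ x ∈ X, f x k * MvPolynomial.eval (fun i => x i) p := by
    intro p hp
    have hnorm : ∀ x ∈ X, ‖x‖ = 1 := fun x hx => norm_eq_one_of_onUnitSphere hX hx
    -- The two summands of `fisherN` count the monomials of degrees `k` and `k - 1`.
    have hTcard : X.card = (degreeExponents d k ∪ degreeExponents d (k - 1)).card := by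
      rw [Finset.card_union_of_disjoint, card_degreeExponents, card_degreeExponents, hcard,
        fisherN, show d + (k - 1) - 1 = d + k - 2 by omega]
      rw [Finset.disjoint_left]
      intro α h1 h2
      rw [mem_degreeExponents] at h1 h2
      omega
    -- Multiplication by `|ξ|²` preserves parity, so one top degree of each parity suffices.
    have htop : ∀ m, m = 2 * k ∨ m = 2 * k - 1 → ∀ q : MvPolynomial (Fin d) ℝ,
        q.IsHomogeneous m →
          sphereMean q = ∑ x ∈ X, f x k * MvPolynomial.eval (fun i => x i) q := by
      intro m hm q hq
      have := sphereMean_eq_sum_of_annihilators hd (n := k) (m := m) (by omega) (by omega) X hnorm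
        (degreeExponents d k ∪ degreeExponents d (k - 1)) hTcard
        (by rcases hm with rfl | rfl
            · rw [show 2 * k - k = k by omega]
              exact Finset.subset_union_left
            · rw [show 2 * k - 1 - k = k - 1 by omega]
              exact Finset.subset_union_right)
        (annihilator k X) hdeg (fun x _ => zonal_mem_restrictSupport hk _ _)
        (fun x hx => annihilator_eval_one hX hx)
        (fun x _ y hy hxy => annihilator_eval_inner hy hxy) hq
      rw [this]
      exact Finset.sum_congr rfl fun x hx => by rw [hw x hx]
    refine sphereMean_eq_sum_of_isHomogeneous X (fun x => f x k) (t := 2 * k) ?_ hp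
    intro n hn q hq
    rcases Nat.even_or_odd n with ⟨c, hc⟩ | ⟨c, hc⟩
    · exact sphereMean_eq_sum_of_lower_degree X hnorm (fun x => f x k) (m := 2 * k)
        (s := k - c) (by omega) (htop _ (Or.inl rfl)) hq
    · exact sphereMean_eq_sum_of_lower_degree X hnorm (fun x => f x k) (m := 2 * k - 1)
        (s := k - 1 - c) (by omega) (htop _ (Or.inr rfl)) hq
  refine ⟨f, hf, ⟨hX, fun x hx => ?_, ?_, hmain⟩, ?_⟩
  -- The weight is a product of the numbers `1 / (1 - α)` with `α < 1` and of positive `λ_l`.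
  · rw [hw x hx, hcoe x hx]
    refine mul_pos (Finset.prod_pos fun α hα => inv_pos.2 ?_) hgpos
    have := lt_one_of_mem_innerSet hX hx hα
    linarith
  · have := hmain 1 (by simp)
    rw [sphereMean_one (by omega)] at this
    simpa using this.symm
  · rw [hcard, fisherBound, if_pos (even_two_mul k), Nat.mul_div_cancel_left k two_pos]

end Annihilators

/-! ### The antipodal case. -/

section Antipodal

variable {d : ℕ}

theorem eval_neg_of_isHomogeneous {n : ℕ} {f : MvPolynomial (Fin d) ℝ} (hf : f.IsHomogeneous n)
    (x : EuclideanSpace ℝ (Fin d)) : MvPolynomial.eval (fun i => (-x) i) f =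
      (-1) ^ n * MvPolynomial.eval (fun i => x i) f := by
  rw [← eval_smul_of_isHomogeneous hf]
  congr 2
  ext i
  simp

theorem neg_ne_of_norm_eq_one {x : EuclideanSpace ℝ (Fin d)} (hx : ‖x‖ = 1) : -x ≠ x := by
  intro h
  have h1 : inner ℝ x (-x) = -inner ℝ x x := inner_neg_right x x
  rw [h, real_inner_self_eq_norm_sq, hx] at h1
  norm_num at h1

/-- A well-ordering of the space selects one point from each pair `x ≠ -x`. -/
theorem exists_half_of_isAntipodal {X : Finset (EuclideanSpace ℝ (Fin d))} (hX : OnUnitSphere X)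
    (hanti : IsAntipodal X) : ∃ Y ⊆ X, (∀ x ∈ Y, -x ∉ Y) ∧
      X.card = 2 * Y.card ∧
      ∀ g : EuclideanSpace ℝ (Fin d) → ℝ, ∑ x ∈ X, g x = ∑ x ∈ Y, (g x + g (-x)) := by
  classical
  let r := @WellOrderingRel (EuclideanSpace ℝ (Fin d))
  have hne : ∀ x ∈ X, x ≠ -x := fun x hx =>
    (neg_ne_of_norm_eq_one (norm_eq_one_of_onUnitSphere hX hx)).symm
  have hasymm : ∀ x y, r x y → ¬ r y x := fun x y => asymm_of r
  set Y := X.filter fun x => r x (-x) with hY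
  have hcompl : X.filter (fun x => ¬ r x (-x)) = Y.image Neg.neg := by
    ext x
    simp only [Finset.mem_filter, Finset.mem_image, hY]
    constructor
    · rintro ⟨hx, hr⟩
      refine ⟨-x, ⟨hanti x hx, ?_⟩, neg_neg x⟩
      rw [neg_neg]
      rcases trichotomous_of r x (-x) with h | h | h
      · exact absurd h hr
      · exact absurd h (hne x hx)
      · exact h
    · rintro ⟨y, ⟨hy, hr⟩, rfl⟩
      refine ⟨hanti y hy, ?_⟩
      rw [neg_neg]
      exact hasymm _ _ hr
  refine ⟨Y, Finset.filter_subset _ _, fun x hx hx' => ?_, ?_, fun g => ?_⟩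
  · rw [hY, Finset.mem_filter] at hx hx'
    rw [neg_neg] at hx'
    exact hasymm _ _ hx.2 hx'.2
  · rw [← Finset.card_filter_add_card_filter_not (fun x => r x (-x)), hcompl,
      Finset.card_image_of_injective _ neg_injective, two_mul]
  · rw [← Finset.sum_filter_add_sum_filter_not X (fun x => r x (-x)), hcompl,
      Finset.sum_image fun x _ y _ h => neg_injective h, Finset.sum_add_distrib]

theorem innerSqSet_neg (X : Finset (EuclideanSpace ℝ (Fin d))) (x : EuclideanSpace ℝ (Fin d)) :
    innerSqSet X (-x) = innerSqSet X x := by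
  simp only [innerSqSet, neg_neg, inner_neg_left, neg_sq, Finset.erase_right_comm]

theorem antipodalAnnihilator_neg (k : ℕ) (X : Finset (EuclideanSpace ℝ (Fin d)))
    (x : EuclideanSpace ℝ (Fin d)) :
    antipodalAnnihilator k X (-x) = antipodalAnnihilator k X x := by
  simp only [antipodalAnnihilator, innerSqSet_neg]

theorem lt_one_of_mem_innerSqSet {X : Finset (EuclideanSpace ℝ (Fin d))} (hX : OnUnitSphere X)
    {x : EuclideanSpace ℝ (Fin d)} (hx : x ∈ X) {β : ℝ} (hβ : β ∈ innerSqSet X x) : β < 1 := by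
  classical
  simp only [innerSqSet, Finset.mem_image, Finset.mem_erase] at hβ
  obtain ⟨-, y, ⟨hyn, hyx, hy⟩, rfl⟩ := hβ
  have hx1 := norm_eq_one_of_onUnitSphere hX hx
  have hy1 := norm_eq_one_of_onUnitSphere hX hy
  have h1 := inner_lt_one hx1 hy1 hyx.symm
  have h2 := inner_lt_one (x := x) (y := -y) hx1 (by rwa [norm_neg])
    (fun h => hyn (by rw [h, neg_neg]))
  rw [inner_neg_right] at h2
  rw [sq_lt_one_iff_abs_lt_one, abs_lt]
  constructor <;> linarith

/-- The point `-x` uses up the inner product `-1`, leaving at most `k - 1` values, a set symmetric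
about zero. Each squared value accounts for `±√β`; if zero also occurs there is one value more,
which leaves a factor `s` in the annihilator to vanish there. -/
theorem two_mul_card_innerSqSet_le {k : ℕ} {X : Finset (EuclideanSpace ℝ (Fin d))}
    (hX : OnUnitSphere X) (hanti : IsAntipodal X) (hloc : IsLocallyKDistanceSet k X)
    {x : EuclideanSpace ℝ (Fin d)} (hx : x ∈ X) :
    2 * (innerSqSet X x).card ≤ k - 1 ∧
      ∀ y ∈ X, y ≠ x → y ≠ -x → inner ℝ x y = 0 → 2 * (innerSqSet X x).card + 1 ≤ k - 1 := by
  classical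
  have hx1 := norm_eq_one_of_onUnitSphere hX hx
  have hxn : -x ≠ x := neg_ne_of_norm_eq_one hx1
  set D := ((X.erase x).erase (-x)).image fun y => inner ℝ x y with hD
  have hmemD : ∀ s, s ∈ D ↔ ∃ y, (y ≠ -x ∧ y ≠ x ∧ y ∈ X) ∧ inner ℝ x y = s := fun s => by
    simp [hD]
  have hDcard : D.card + 1 ≤ k := by
    have hsub : insert (-1 : ℝ) D ⊆ innerSet X x := by
      intro s hs
      rw [Finset.mem_insert] at hs
      rw [innerSet, Finset.mem_image]
      rcases hs with rfl | hs
      · refine ⟨-x, Finset.mem_erase.2 ⟨hxn, hanti x hx⟩, ?_⟩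
        rw [inner_neg_right, real_inner_self_eq_norm_sq, hx1, one_pow]
      · obtain ⟨y, ⟨-, h1, h2⟩, h3⟩ := (hmemD s).1 hs
        exact ⟨y, Finset.mem_erase.2 ⟨h1, h2⟩, h3⟩
    have hnot : (-1 : ℝ) ∉ D := by
      intro h
      obtain ⟨y, ⟨hyn, -, hy⟩, h3⟩ := (hmemD _).1 h
      have := inner_lt_one (x := x) (y := -y) hx1
        (by rw [norm_neg]; exact norm_eq_one_of_onUnitSphere hX hy)
        (fun h => hyn (by rw [h, neg_neg]))
      rw [inner_neg_right, h3] at this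
      norm_num at this
    rw [← Finset.card_insert_of_notMem hnot]
    exact (Finset.card_le_card hsub).trans ((card_innerSet_le hX hx).trans (hloc x hx))
  have hDneg : ∀ s ∈ D, -s ∈ D := by
    intro s hs
    obtain ⟨y, ⟨h1, h2, h3⟩, h4⟩ := (hmemD s).1 hs
    refine (hmemD _).2 ⟨-y, ⟨fun h => h2 (neg_injective h), fun h => h1 ?_, hanti y h3⟩, ?_⟩
    · rw [← h, neg_neg]
    · rw [inner_neg_right, h4]
  have hB : ∀ β ∈ innerSqSet X x, 0 < β ∧ Real.sqrt β ∈ D := by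
    intro β hβ
    simp only [innerSqSet, Finset.mem_image, Finset.mem_erase] at hβ
    obtain ⟨h0, y, hy, rfl⟩ := hβ
    refine ⟨lt_of_le_of_ne (sq_nonneg _) (Ne.symm h0), ?_⟩
    have hs : inner ℝ x y ∈ D := (hmemD _).2 ⟨y, hy, rfl⟩
    rw [Real.sqrt_sq_eq_abs]
    rcases abs_choice (inner ℝ x y) with h | h <;> rw [h]
    · exact hs
    · exact hDneg _ hs
  have hunion : (innerSqSet X x).image Real.sqrt ∪
      (innerSqSet X x).image (fun β => -Real.sqrt β) ⊆ D.erase 0 := by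
    intro s hs
    rw [Finset.mem_union, Finset.mem_image, Finset.mem_image] at hs
    rcases hs with ⟨β, hβ, rfl⟩ | ⟨β, hβ, rfl⟩
    · exact Finset.mem_erase.2 ⟨(Real.sqrt_pos.2 (hB β hβ).1).ne', (hB β hβ).2⟩
    · exact Finset.mem_erase.2
        ⟨neg_ne_zero.2 (Real.sqrt_pos.2 (hB β hβ).1).ne', hDneg _ (hB β hβ).2⟩
  have hinj : Set.InjOn Real.sqrt (innerSqSet X x : Set ℝ) := fun a ha b hb h =>
    (Real.sqrt_inj (hB a ha).1.le (hB b hb).1.le).1 h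
  have hinj' : Set.InjOn (fun β => -Real.sqrt β) (innerSqSet X x : Set ℝ) := fun a ha b hb h =>
    hinj ha hb (neg_injective h)
  have hcard : 2 * (innerSqSet X x).card ≤ (D.erase 0).card := by
    have h := Finset.card_le_card hunion
    rw [Finset.card_union_of_disjoint, Finset.card_image_of_injOn hinj,
      Finset.card_image_of_injOn hinj'] at h
    · omega
    · rw [Finset.disjoint_left]
      intro s h1 h2
      rw [Finset.mem_image] at h1 h2
      obtain ⟨a, ha, rfl⟩ := h1
      obtain ⟨b, hb, hab⟩ := h2
      have := Real.sqrt_pos.2 (hB a ha).1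
      have := Real.sqrt_pos.2 (hB b hb).1
      linarith
  refine ⟨?_, fun y hy hyx hyn h0 => ?_⟩
  · have := Finset.card_erase_le (s := D) (a := 0)
    omega
  · have h0D : (0 : ℝ) ∈ D := (hmemD 0).2 ⟨y, ⟨hyn, hyx, hy⟩, h0⟩
    have := Finset.card_erase_add_one h0D
    omega

theorem antipodalAnnihilator_natDegree_le_and_coeff {k : ℕ}
    {X : Finset (EuclideanSpace ℝ (Fin d))} {x : EuclideanSpace ℝ (Fin d)}
    (hk : 2 * (innerSqSet X x).card ≤ k - 1) :
    (antipodalAnnihilator k X x).natDegree ≤ k - 1 ∧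
      (antipodalAnnihilator k X x).coeff (k - 1) = ∏ β ∈ innerSqSet X x, (1 - β)⁻¹ := by
  have := natDegree_le_and_coeff_X_pow_mul_prod (innerSqSet X x) (fun β => Polynomial.X ^ 2 - Polynomial.C β) 2
    (k - 1 - 2 * (innerSqSet X x).card)
    fun β _ => ⟨Polynomial.monic_X_pow_sub_C β two_ne_zero, Polynomial.natDegree_X_pow_sub_C⟩
  rwa [Nat.sub_add_cancel hk] at this

/-- The product is a polynomial in `s²`, so the power of `s` in front fixes the parity. This makes
the zonal polynomial homogeneous. -/
theorem antipodalAnnihilator_coeff_parity {k : ℕ} {X : Finset (EuclideanSpace ℝ (Fin d))}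
    {x : EuclideanSpace ℝ (Fin d)} (hk : 2 * (innerSqSet X x).card ≤ k - 1) {j : ℕ}
    (hj : (antipodalAnnihilator k X x).coeff j ≠ 0) : Even (k - 1 - j) := by
  have hprod : ∏ β ∈ innerSqSet X x,
      (Polynomial.C (1 - β)⁻¹ * (Polynomial.X ^ 2 - Polynomial.C β)) =
      Polynomial.expand ℝ 2 (∏ β ∈ innerSqSet X x,
        (Polynomial.C (1 - β)⁻¹ * (Polynomial.X - Polynomial.C β))) := by
    rw [map_prod]
    refine Finset.prod_congr rfl fun β _ => ?_
    rw [map_mul, map_sub, Polynomial.expand_C, Polynomial.expand_C, Polynomial.expand_X]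
  rw [antipodalAnnihilator, hprod, Polynomial.coeff_X_pow_mul'] at hj
  split_ifs at hj with h1
  · rw [Polynomial.coeff_expand two_pos] at hj
    split_ifs at hj with h2
    · rw [Nat.even_iff]
      omega
    · exact absurd rfl hj
  · exact absurd rfl hj

theorem antipodalAnnihilator_eval_one {k : ℕ} {X : Finset (EuclideanSpace ℝ (Fin d))}
    (hX : OnUnitSphere X) {x : EuclideanSpace ℝ (Fin d)} (hx : x ∈ X) :
    (antipodalAnnihilator k X x).eval 1 = 1 := by
  simp only [antipodalAnnihilator, Polynomial.eval_mul, Polynomial.eval_pow, Polynomial.eval_X,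
    one_pow, one_mul, Polynomial.eval_prod, Polynomial.eval_C, Polynomial.eval_sub]
  refine Finset.prod_eq_one fun β hβ => inv_mul_cancel₀ ?_
  have := lt_one_of_mem_innerSqSet hX hx hβ
  linarith

theorem antipodalAnnihilator_eval_inner {k : ℕ} {X : Finset (EuclideanSpace ℝ (Fin d))}
    (hX : OnUnitSphere X) (hanti : IsAntipodal X) (hloc : IsLocallyKDistanceSet k X)
    {x y : EuclideanSpace ℝ (Fin d)} (hx : x ∈ X) (hy : y ∈ X) (hyx : y ≠ x) (hyn : y ≠ -x) :
    (antipodalAnnihilator k X x).eval (inner ℝ x y) = 0 := by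
  classical
  rw [antipodalAnnihilator, Polynomial.eval_mul]
  by_cases h0 : inner ℝ x y = 0
  · have := (two_mul_card_innerSqSet_le hX hanti hloc hx).2 y hy hyx hyn h0
    apply mul_eq_zero_of_left
    rw [Polynomial.eval_pow, Polynomial.eval_X, h0, zero_pow (by omega)]
  · apply mul_eq_zero_of_right
    rw [Polynomial.eval_prod]
    refine Finset.prod_eq_zero (i := (inner ℝ x y) ^ 2) ?_ (by simp)
    simp only [innerSqSet, Finset.mem_erase, Finset.mem_image]
    exact ⟨pow_ne_zero 2 h0, y, ⟨hyn, hyx, hy⟩, rfl⟩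

/-- The design obtained from an antipodal locally `k`-distance set attaining the upper bound. -/
theorem isTightDesign_of_antipodal_locallyKDistance {k : ℕ} (hd : 2 ≤ d) (hk : 1 ≤ k)
    {X : Finset (EuclideanSpace ℝ (Fin d))} (hX : OnUnitSphere X) (hanti : IsAntipodal X)
    (hloc : IsLocallyKDistanceSet k X) (hcard : X.card = fisherN' d k) :
    ∃ f : EuclideanSpace ℝ (Fin d) → ℕ → ℝ,
      (∀ x ∈ X, IsGegenbauerExpansion d (k - 1) (antipodalAnnihilator k X x) (f x)) ∧
      IsTightWeightedSphericalDesign X (fun x => f x (k - 1) / 2) (2 * k - 1) := by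
  have hle := fun x hx => (two_mul_card_innerSqSet_le hX hanti hloc (x := x) hx).1
  have hdeg := fun x hx => (antipodalAnnihilator_natDegree_le_and_coeff (hle x hx)).1
  have hcoe := fun x hx => (antipodalAnnihilator_natDegree_le_and_coeff (hle x hx)).2
  have hex : ∀ x : EuclideanSpace ℝ (Fin d), ∃ f : ℕ → ℝ,
      x ∈ X → IsGegenbauerExpansion d (k - 1) (antipodalAnnihilator k X x) f := fun x => by
    by_cases hx : x ∈ X
    · obtain ⟨f, hf⟩ := exists_isGegenbauerExpansion hd (k - 1) _ (hdeg x hx)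
      exact ⟨f, fun _ => hf⟩
    · exact ⟨0, fun h => absurd h hx⟩
  choose f hf using hex
  set g := ∏ l ∈ Finset.range (k - 1), gegenbauerLambda d (l + 1) with hg
  have hgpos : 0 < g := Finset.prod_pos fun l _ => gegenbauerLambda_succ_pos hd l
  have hw : ∀ x ∈ X, f x (k - 1) = (antipodalAnnihilator k X x).coeff (k - 1) * g :=
    fun x hx => by rw [(hf x hx).coeff_eq, inv_mul_cancel_right₀ hgpos.ne']
  have hwneg : ∀ x ∈ X, f (-x) (k - 1) = f x (k - 1) := fun x hx => by
    rw [hw _ (hanti x hx), hw x hx, antipodalAnnihilator_neg]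
  have hnorm : ∀ x ∈ X, ‖x‖ = 1 := fun x hx => norm_eq_one_of_onUnitSphere hX hx
  obtain ⟨Y, hYX, hYneg, hYcard, hYsum⟩ := exists_half_of_isAntipodal hX hanti
  -- The cubature is found on the half `Y`, whose size is the dimension of `Hom_{k-1}`. In even
  -- degree each weight can be shared equally between `x` and `-x`.
  have htop : ∀ q : MvPolynomial (Fin d) ℝ, q.IsHomogeneous (2 * (k - 1)) →
      sphereMean q = ∑ x ∈ X, f x (k - 1) / 2 * MvPolynomial.eval (fun i => x i) q := by
    intro q hq
    have := sphereMean_eq_sum_of_annihilators hd (n := k - 1) (m := 2 * (k - 1)) (by omega)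
      (by omega) Y (fun x hx => hnorm x (hYX hx)) (degreeExponents d (k - 1))
      (by
        rw [card_degreeExponents, show d + (k - 1) - 1 = d + k - 2 by omega]
        rw [hYcard, fisherN'] at hcard
        omega)
      (by rw [show 2 * (k - 1) - (k - 1) = k - 1 by omega])
      (antipodalAnnihilator k X) (fun x hx => hdeg x (hYX hx))
      (fun x hx => by
        rw [← isHomogeneous_iff_mem_restrictSupport]
        refine zonal_isHomogeneous _ _ fun j _ hc => ?_
        rw [Polynomial.coeff_map] at hc
        exact antipodalAnnihilator_coeff_parity (hle x (hYX hx))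
          (fun h => hc (by rw [h, map_zero])))
      (fun x hx => antipodalAnnihilator_eval_one hX (hYX hx))
      (fun x hx y hy hxy => antipodalAnnihilator_eval_inner hX hanti hloc (hYX hx) (hYX hy)
        hxy.symm (fun h => hYneg x hx (h ▸ hy))) hq
    rw [this, hYsum]
    refine Finset.sum_congr rfl fun x hx => ?_
    rw [eval_neg_of_isHomogeneous hq, hwneg x (hYX hx), ← hw x (hYX hx),
      (even_two_mul (k - 1)).neg_one_pow]
    ring
  have hmain : ∀ p : MvPolynomial (Fin d) ℝ, p.totalDegree ≤ 2 * k - 1 →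
      sphereMean p = ∑ x ∈ X, f x (k - 1) / 2 * MvPolynomial.eval (fun i => x i) p := by
    intro p hp
    refine sphereMean_eq_sum_of_isHomogeneous X (fun x => f x (k - 1) / 2) (t := 2 * k - 1) ?_ hp
    intro n hn q hq
    rcases Nat.even_or_odd n with hev | hodd
    · obtain ⟨c, hc⟩ := hev
      exact sphereMean_eq_sum_of_lower_degree X hnorm (fun x => f x (k - 1) / 2)
        (m := 2 * (k - 1)) (s := k - 1 - c) (by omega) htop hq
    -- In odd degree the contributions of `x` and `-x` cancel, since their weights agree.
    · rw [sphereMean_eq_zero_of_odd hd hodd hq, hYsum, Finset.sum_eq_zero]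
      intro x hx
      rw [eval_neg_of_isHomogeneous hq, hwneg x (hYX hx), hodd.neg_one_pow]
      ring
  refine ⟨f, hf, ⟨hX, fun x hx => ?_, ?_, hmain⟩, ?_⟩
  · rw [hw x hx, hcoe x hx]
    refine div_pos (mul_pos (Finset.prod_pos fun α hα => inv_pos.2 ?_) hgpos) two_pos
    have := lt_one_of_mem_innerSqSet hX hx hα
    linarith
  · have := hmain 1 (by simp)
    rw [sphereMean_one (by omega)] at this
    simpa using this.symm
  · rw [hcard, fisherBound, if_neg, show (2 * k - 1 + 1) / 2 = k by omega]
    rw [Nat.even_iff]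
    omega

end Antipodal

/-! ### Zonal means and reproducing kernels. -/

section ZonalMean

open MvPolynomial

variable {d : ℕ}

theorem eval_eq_zero_of_sphereMean_eq_zero_vec (hd : 2 ≤ d) {f : MvPolynomial (Fin d) ℝ}
    (hnn : ∀ v : Fin d → ℝ, v ⬝ᵥ v = 1 → 0 ≤ eval v f) (h0 : sphereMean f = 0)
    (v : Fin d → ℝ) (hv : v ⬝ᵥ v = 1) : eval v f = 0 := by
  refine eval_eq_zero_of_sphereMean_eq_zero (by omega)
    (fun x hx => hnn _ (dotProduct_self_of_norm_eq_one hx)) h0 (WithLp.toLp 2 v) ?_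
  have h1 : ‖WithLp.toLp 2 v‖ ^ 2 = 1 := by
    rw [EuclideanSpace.real_norm_sq_eq]
    simpa [dotProduct, sq] using hv
  exact (pow_eq_one_iff_of_nonneg (norm_nonneg _) two_ne_zero).1 h1

theorem eval_aeval_linForm (x v : Fin d → ℝ) (p : ℝ[X]) :
    eval v (Polynomial.aeval (linForm x) p) = p.eval (x ⬝ᵥ v) := by
  rw [← eval_linForm x v, ← Polynomial.coe_aeval_eq_eval, ← coe_aeval_eq_eval,
    RingHom.coe_coe, ← Polynomial.aeval_algHom_apply]

theorem totalDegree_aeval_linForm_le (x : Fin d → ℝ) (p : ℝ[X]) :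
    (Polynomial.aeval (linForm x) p).totalDegree ≤ p.natDegree := by
  rw [Polynomial.aeval_eq_sum_range]
  refine totalDegree_finsetSum_le fun j hj => ?_
  refine (totalDegree_smul_le _ _).trans ?_
  have := ((linForm_isHomogeneous x).pow j).totalDegree_le
  have := Finset.mem_range.1 hj
  omega

theorem dotProduct_mem_Icc {x v : Fin d → ℝ} (hx : x ⬝ᵥ x = 1) (hv : v ⬝ᵥ v = 1) :
    -1 ≤ x ⬝ᵥ v ∧ x ⬝ᵥ v ≤ 1 := by
  have h1 : 0 ≤ (x + v) ⬝ᵥ (x + v) := Finset.sum_nonneg fun i _ => mul_self_nonneg _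
  have h2 : 0 ≤ (x - v) ⬝ᵥ (x - v) := Finset.sum_nonneg fun i _ => mul_self_nonneg _
  simp only [add_dotProduct, dotProduct_add, sub_dotProduct, dotProduct_sub, hx, hv,
    dotProduct_comm v x] at h1 h2
  constructor <;> linarith

theorem exists_unit_dotProduct_eq (hd : 2 ≤ d) {x : Fin d → ℝ} (hx : x ⬝ᵥ x = 1) {s : ℝ}
    (hs : s ∈ Set.Icc (-1 : ℝ) 1) : ∃ v : Fin d → ℝ, v ⬝ᵥ v = 1 ∧ x ⬝ᵥ v = s := by
  obtain ⟨b, hb, hxb⟩ := exists_orthogonal_same_norm hd x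
  have h1 : 0 ≤ 1 - s ^ 2 := by nlinarith [hs.1, hs.2]
  have h2 := Real.mul_self_sqrt h1
  refine ⟨s • x + Real.sqrt (1 - s ^ 2) • b, ?_, ?_⟩
  · simp only [add_dotProduct, dotProduct_add, smul_dotProduct, dotProduct_smul, smul_eq_mul, hx,
      hb, hxb, dotProduct_comm b x]
    linarith
  · simp only [dotProduct_add, dotProduct_smul, smul_eq_mul, hx, hxb]
    ring

/-- As `d ≥ 2`, the values `(x,v)` fill `[-1,1]`, so `p` has infinitely many roots. -/
theorem eq_zero_of_sphereMean_aeval_eq_zero (hd : 2 ≤ d) {x : Fin d → ℝ} (hx : x ⬝ᵥ x = 1)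
    {p : ℝ[X]} (hnn : ∀ s ∈ Set.Icc (-1 : ℝ) 1, 0 ≤ p.eval s)
    (h0 : sphereMean (Polynomial.aeval (linForm x) p) = 0) : p = 0 := by
  have hz := eval_eq_zero_of_sphereMean_eq_zero_vec hd (fun v hv => by
    rw [eval_aeval_linForm]
    exact hnn _ (dotProduct_mem_Icc hx hv)) h0
  refine Polynomial.eq_zero_of_infinite_isRoot p
    ((Set.Icc_infinite (show (-1 : ℝ) < 1 by norm_num)).mono fun s hs => ?_)
  obtain ⟨v, hv, rfl⟩ := exists_unit_dotProduct_eq hd hx hs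
  have := hz v hv
  rwa [eval_aeval_linForm] at this

/-- The recursion involves `x` only through `(x,x) = 1`; this is the rotation invariance that is
needed. -/
theorem momentMap_linForm_pow_congr (hd : 2 ≤ d) {x y : Fin d → ℝ} (hx : x ⬝ᵥ x = 1)
    (hy : y ⬝ᵥ y = 1) (n : ℕ) :
    momentMap ℝ (linForm x ^ n) = momentMap ℝ (linForm y ^ n) := by
  induction n using Nat.strong_induction_on with
  | _ n ih =>
    rcases n with _ | n
    · rw [pow_zero, pow_zero]
    · have h1 := momentMap_linForm_pow_succ_mul (K := ℝ) (by omega) x x n 0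
      have h2 := momentMap_linForm_pow_succ_mul (K := ℝ) (by omega) y y n 0
      have h3 := natCast_add_natCast_sub_one_ne_zero (K := ℝ) hd n
      simp only [pow_zero, mul_one, Nat.cast_zero, add_zero, zero_mul, hx, hy] at h1 h2
      apply mul_left_cancel₀ h3
      rw [h1, h2, ih (n - 1) (by omega)]

theorem sphereMean_aeval_linForm_congr (hd : 2 ≤ d) {x y : Fin d → ℝ} (hx : x ⬝ᵥ x = 1)
    (hy : y ⬝ᵥ y = 1) (p : ℝ[X]) :
    sphereMean (Polynomial.aeval (linForm x) p) = sphereMean (Polynomial.aeval (linForm y) p) := by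
  rw [← momentMap_real, ← momentMap_real, Polynomial.aeval_eq_sum_range,
    Polynomial.aeval_eq_sum_range, map_sum, map_sum]
  refine Finset.sum_congr rfl fun j _ => ?_
  rw [map_smul, map_smul, momentMap_linForm_pow_congr hd hx hy]

theorem momentMap_orthogonal_odd (hd : 2 ≤ d) {x b : Fin d → ℝ} (hbx : b ⬝ᵥ x = 0) (m j : ℕ)
    (hj : Odd j) : momentMap ℝ (linForm b ^ j * linForm x ^ m) = 0 := by
  induction j using Nat.strong_induction_on with
  | _ j ih =>
    obtain ⟨c, rfl⟩ := hj
    have h := momentMap_linForm_pow_succ_mul (K := ℝ) (by omega) b x (2 * c) m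
    have h2 := natCast_add_natCast_sub_one_ne_zero (K := ℝ) hd (2 * c + m)
    rw [Nat.cast_add, ← add_assoc] at h2
    have h0 : ((2 * c : ℕ) : ℝ) * momentMap ℝ (linForm b ^ (2 * c - 1) * linForm x ^ m) = 0 := by
      rcases Nat.eq_zero_or_pos c with rfl | hc
      · simp
      · rw [ih (2 * c - 1) (by omega) ⟨c - 1, by omega⟩, mul_zero]
    rw [hbx, mul_right_comm, h0] at h
    simp only [zero_mul, mul_zero, add_zero] at h
    exact (mul_eq_zero.1 h).resolve_left h2

/-- Two instances of the recursion share the factor `d + j + m`, which cancels. Geometrically, the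
slice `(x,ξ) = s` is a sphere of squared radius `1 - s²`. -/
theorem momentMap_orthogonal_add_two (hd : 2 ≤ d) {x b : Fin d → ℝ} (hx : x ⬝ᵥ x = 1)
    (hbx : b ⬝ᵥ x = 0) (m j : ℕ) :
    ((d : ℝ) + j - 1) * momentMap ℝ (linForm b ^ (j + 2) * linForm x ^ m) =
      (j + 1) * (b ⬝ᵥ b) * (momentMap ℝ (linForm b ^ j * linForm x ^ m) -
        momentMap ℝ (linForm b ^ j * linForm x ^ (m + 2))) := by
  have h1 := momentMap_linForm_pow_succ_mul (K := ℝ) (by omega) b x (j + 1) m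
  have h2 := momentMap_linForm_pow_succ_mul (K := ℝ) (by omega) x b (m + 1) j
  have h3 := natCast_add_natCast_sub_one_ne_zero (K := ℝ) hd (j + m + 1)
  rw [hbx] at h1
  rw [dotProduct_comm x b, hbx, hx] at h2
  simp only [mul_zero, zero_mul, add_zero, Nat.add_sub_cancel, mul_one] at h1 h2
  rw [mul_comm (linForm x ^ m), mul_comm (linForm x ^ (m + 1 + 1))] at h2
  push_cast at h1 h2 h3
  apply mul_left_cancel₀ h3
  linear_combination ((d : ℝ) + j - 1) * h1 + (j + 1) * (b ⬝ᵥ b) * h2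

theorem momentMap_orthogonal_add_two_aeval (hd : 2 ≤ d) {x b : Fin d → ℝ} (hx : x ⬝ᵥ x = 1)
    (hbx : b ⬝ᵥ x = 0) (j : ℕ) (p : ℝ[X]) :
    ((d : ℝ) + j - 1) * momentMap ℝ (linForm b ^ (j + 2) * Polynomial.aeval (linForm x) p) =
      (j + 1) * (b ⬝ᵥ b) * momentMap ℝ (linForm b ^ j *
        Polynomial.aeval (linForm x) ((1 - Polynomial.X ^ 2) * p)) := by
  induction p using Polynomial.induction_on' with
  | add p q hp hq => simp only [map_add, mul_add, hp, hq]
  | monomial m c =>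
    have h := momentMap_orthogonal_add_two hd hx hbx m j
    have e1 : Polynomial.aeval (linForm x) (Polynomial.monomial m c) =
        c • linForm x ^ m := by
      rw [Polynomial.aeval_monomial, smul_eq_C_mul]
      rfl
    have e2 : Polynomial.aeval (linForm x) ((1 - Polynomial.X ^ 2) * Polynomial.monomial m c) =
        c • (linForm x ^ m - linForm x ^ (m + 2)) := by
      rw [map_mul, e1, map_sub, map_one, map_pow, Polynomial.aeval_X, mul_smul_comm]
      congr 1
      ring
    rw [e1, e2, mul_smul_comm, mul_smul_comm, map_smul, map_smul, mul_sub, map_sub, smul_eq_mul,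
      smul_eq_mul]
    linear_combination c * h

theorem momentMap_orthogonal_odd_aeval (hd : 2 ≤ d) {x b : Fin d → ℝ}
    (hbx : b ⬝ᵥ x = 0) {j : ℕ} (hj : Odd j) (p : ℝ[X]) :
    momentMap ℝ (linForm b ^ j * Polynomial.aeval (linForm x) p) = 0 := by
  rw [Polynomial.aeval_eq_sum_range, Finset.mul_sum, map_sum]
  refine Finset.sum_eq_zero fun m _ => ?_
  rw [mul_smul_comm, map_smul, momentMap_orthogonal_odd hd hbx m j hj, smul_zero]

theorem exists_momentMap_orthogonal_even (hd : 2 ≤ d) {x b : Fin d → ℝ} (hx : x ⬝ᵥ x = 1)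
    (hbx : b ⬝ᵥ x = 0) (h : ℕ) : ∃ κ : ℝ, ∀ p : ℝ[X],
      momentMap ℝ (linForm b ^ (2 * h) * Polynomial.aeval (linForm x) p) =
        κ * momentMap ℝ (Polynomial.aeval (linForm x) ((1 - Polynomial.X ^ 2) ^ h * p)) := by
  induction h with
  | zero => exact ⟨1, fun p => by simp⟩
  | succ h ih =>
    obtain ⟨κ, hκ⟩ := ih
    refine ⟨((2 * h : ℕ) + 1) * (b ⬝ᵥ b) * κ / ((d : ℝ) + (2 * h : ℕ) - 1), fun p => ?_⟩
    have h3 := natCast_add_natCast_sub_one_ne_zero (K := ℝ) hd (2 * h)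
    have h4 := momentMap_orthogonal_add_two_aeval hd hx hbx (2 * h) p
    rw [hκ, ← mul_assoc ((1 - Polynomial.X ^ 2) ^ h), ← pow_succ] at h4
    apply mul_left_cancel₀ h3
    rw [show 2 * (h + 1) = 2 * h + 2 by ring, h4]
    field_simp

/-- `C` is the kernel reproducing the homogeneous polynomials of degree `e` on the sphere. -/
structure IsHomogeneousKernel (d e : ℕ) (C : ℝ[X]) : Prop where
  natDegree_le : C.natDegree ≤ e
  parity : ∀ j, C.coeff j ≠ 0 → Even (e - j)
  mean_mul_pow : ∀ x : Fin d → ℝ, x ⬝ᵥ x = 1 → ∀ i, 2 * i ≤ e →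
    sphereMean (Polynomial.aeval (linForm x) (C * Polynomial.X ^ (e - 2 * i))) = 1

/-- The conditions form a linear system for the coefficients of `C` in the monomials `s^{e-2i}`. Its
matrix is their Gram matrix under the zonal mean, which is nonsingular because a square of mean zero
is zero. The right-hand side `1` is the value of each monomial at `s = 1`. -/
theorem exists_isHomogeneousKernel (hd : 2 ≤ d) (e : ℕ) : ∃ C, IsHomogeneousKernel d e C := by
  classical
  let x₀ : Fin d → ℝ := Pi.single ⟨0, by omega⟩ 1
  have hx₀ : x₀ ⬝ᵥ x₀ = 1 := by simp [x₀]
  let ν : ℝ[X] →ₗ[ℝ] ℝ := (sphereMeanLinear d).comp (Polynomial.aeval (linForm x₀)).toLinearMap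
  have hν : ∀ p, ν p = sphereMean (Polynomial.aeval (linForm x₀) p) := fun p => rfl
  let Φ : (Fin (e / 2 + 1) → ℝ) →ₗ[ℝ] ℝ[X] :=
    Fintype.linearCombination ℝ fun i : Fin (e / 2 + 1) => (Polynomial.X ^ (e - 2 * (i : ℕ)) : ℝ[X])
  have hΦ : ∀ c, Φ c = ∑ i : Fin (e / 2 + 1), c i • (Polynomial.X ^ (e - 2 * (i : ℕ)) : ℝ[X]) :=
    fun c => Fintype.linearCombination_apply ..
  have hΦcoeff : ∀ c (i : Fin (e / 2 + 1)), (Φ c).coeff (e - 2 * (i : ℕ)) = c i := by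
    intro c i
    rw [hΦ, Polynomial.finsetSum_coeff, Finset.sum_eq_single i]
    · simp
    · intro j _ hj
      have : e - 2 * (i : ℕ) ≠ e - 2 * (j : ℕ) := by
        intro h
        apply hj
        ext
        have := i.2
        have := j.2
        omega
      simp [Polynomial.coeff_X_pow, this]
    · simp
  let Ψ : (Fin (e / 2 + 1) → ℝ) →ₗ[ℝ] Fin (e / 2 + 1) → ℝ := LinearMap.pi fun i =>
    ν.comp ((LinearMap.mulRight ℝ (Polynomial.X ^ (e - 2 * (i : ℕ)) : ℝ[X])).comp Φ)
  have hΨ : ∀ c i, Ψ c i = ν (Φ c * Polynomial.X ^ (e - 2 * (i : ℕ))) := fun c i => rfl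
  have hinj : Function.Injective Ψ := by
    rw [injective_iff_map_eq_zero]
    intro c hc
    have h1 : ν (Φ c * Φ c) = 0 := by
      conv_lhs => rw [hΦ c, Finset.mul_sum, map_sum, ← hΦ c]
      refine Finset.sum_eq_zero fun i _ => ?_
      rw [mul_smul_comm, map_smul, ← hΨ, hc, Pi.zero_apply, smul_zero]
    have h2 : Φ c * Φ c = 0 := eq_zero_of_sphereMean_aeval_eq_zero hd hx₀
      (fun s _ => by rw [Polynomial.eval_mul]; exact mul_self_nonneg _) h1
    ext i
    rw [← hΦcoeff c i, mul_self_eq_zero.1 h2, Polynomial.coeff_zero, Pi.zero_apply]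
  obtain ⟨c, hc⟩ := (LinearMap.injective_iff_surjective.1 hinj) 1
  refine ⟨Φ c, ?_, fun j hj => ?_, fun x hx i hi => ?_⟩
  · rw [hΦ]
    refine Polynomial.natDegree_sum_le_of_forall_le _ _ fun i _ => ?_
    refine (Polynomial.natDegree_smul_le _ _).trans ?_
    rw [Polynomial.natDegree_X_pow]
    omega
  · rw [hΦ, Polynomial.finsetSum_coeff] at hj
    obtain ⟨i, -, hi⟩ := Finset.exists_ne_zero_of_sum_ne_zero hj
    rw [Polynomial.coeff_smul, Polynomial.coeff_X_pow] at hi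
    split_ifs at hi with h
    · have := i.2
      exact ⟨i, by omega⟩
    · simp at hi
  · rw [sphereMean_aeval_linForm_congr hd hx hx₀, ← hν]
    have := congrFun hc ⟨i, by omega⟩
    rwa [hΨ] at this

namespace IsHomogeneousKernel

variable {e : ℕ} {C : ℝ[X]}

/-- Each factor `1 - s²` takes a difference of consecutive means; these all equal `1`, so the first
difference already vanishes. -/
theorem mean_one_sub_sq_pow_mul (hC : IsHomogeneousKernel d e C) {x : Fin d → ℝ}
    (hx : x ⬝ᵥ x = 1) (h i : ℕ) (hi : 2 * (h + 1) + 2 * i ≤ e) :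
    momentMap ℝ (Polynomial.aeval (linForm x)
      ((1 - Polynomial.X ^ 2) ^ (h + 1) * (C * Polynomial.X ^ (e - 2 * (h + 1) - 2 * i)))) = 0 := by
  induction h generalizing i with
  | zero =>
    have h1 := hC.mean_mul_pow x hx (i + 1) (by omega)
    have h2 := hC.mean_mul_pow x hx i (by omega)
    rw [← momentMap_real] at h1 h2
    have : (1 - Polynomial.X ^ 2) ^ (0 + 1) * (C * Polynomial.X ^ (e - 2 * (0 + 1) - 2 * i)) =
        C * Polynomial.X ^ (e - 2 * (i + 1)) - C * Polynomial.X ^ (e - 2 * i) := by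
      rw [show e - 2 * i = e - 2 * (i + 1) + 2 by omega,
        show e - 2 * (0 + 1) - 2 * i = e - 2 * (i + 1) by omega]
      ring
    rw [this, map_sub, map_sub, h1, h2, sub_self]
  | succ h ih =>
    have h1 := ih (i + 1) (by omega)
    have h2 := ih i (by omega)
    have : (1 - Polynomial.X ^ 2) ^ (h + 1 + 1) *
        (C * Polynomial.X ^ (e - 2 * (h + 1 + 1) - 2 * i)) =
        (1 - Polynomial.X ^ 2) ^ (h + 1) * (C * Polynomial.X ^ (e - 2 * (h + 1) - 2 * (i + 1))) -
        (1 - Polynomial.X ^ 2) ^ (h + 1) * (C * Polynomial.X ^ (e - 2 * (h + 1) - 2 * i)) := by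
      rw [show e - 2 * (h + 1) - 2 * i = e - 2 * (h + 1) - 2 * (i + 1) + 2 by omega,
        show e - 2 * (h + 1 + 1) - 2 * i = e - 2 * (h + 1) - 2 * (i + 1) by omega]
      ring
    rw [this, map_sub, map_sub, h1, h2, sub_self]

/-- It suffices to test `(a,ξ)^e`. Write `a = αx + b` with `b` orthogonal to `x` and expand: odd
powers of `b` have mean zero, positive even powers turn into powers of `1 - s²` and vanish, and the
remaining term is `α^e = (a,x)^e`. -/
theorem mean_mul (hC : IsHomogeneousKernel d e C) (hd : 2 ≤ d) {x : Fin d → ℝ}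
    (hx : x ⬝ᵥ x = 1) {f : MvPolynomial (Fin d) ℝ} (hf : f.IsHomogeneous e) :
    sphereMean (Polynomial.aeval (linForm x) C * f) = eval x f := by
  let Λ : MvPolynomial (Fin d) ℝ →ₗ[ℝ] ℝ :=
    (momentMap ℝ).comp (LinearMap.mulLeft ℝ (Polynomial.aeval (linForm x) C)) -
      (aeval x : MvPolynomial (Fin d) ℝ →ₐ[ℝ] ℝ).toLinearMap
  have hΛ : ∀ g, Λ g = momentMap ℝ (Polynomial.aeval (linForm x) C * g) - eval x g := fun g => by
    simp [Λ, aeval_eq_eval]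
  suffices h : Λ f = 0 by
    rw [hΛ, momentMap_real] at h
    linarith
  refine map_eq_zero_of_linForm_pow Λ (fun a => ?_) hf
  set α := a ⬝ᵥ x with hα
  set b := a - α • x with hb
  have hbx : b ⬝ᵥ x = 0 := by
    rw [hb, sub_dotProduct, smul_dotProduct, hx, smul_eq_mul, mul_one, hα, sub_self]
  have ha : linForm a = linForm b + α • linForm x := by
    rw [← linForm_smul, ← linForm_add, hb, sub_add_cancel]
  have hterm : ∀ j, momentMap ℝ (Polynomial.aeval (linForm x) C *
      (linForm b ^ j * (α • linForm x) ^ (e - j) * ((e.choose j : ℕ) : MvPolynomial (Fin d) ℝ))) =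
      ((e.choose j : ℝ) * α ^ (e - j)) * momentMap ℝ (linForm b ^ j *
        Polynomial.aeval (linForm x) (C * Polynomial.X ^ (e - j))) := by
    intro j
    rw [← smul_eq_mul ((e.choose j : ℝ) * α ^ (e - j)), ← map_smul]
    congr 1
    rw [smul_pow, smul_eq_C_mul, smul_eq_C_mul, map_mul, map_mul, map_natCast, map_pow, map_pow,
      Polynomial.aeval_X]
    ring
  rw [hΛ, map_pow, eval_linForm, ← hα, ha, add_pow, Finset.mul_sum, map_sum,
    Finset.sum_eq_single 0]
  · rw [hterm, pow_zero, one_mul, momentMap_real, Nat.sub_zero]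
    have := hC.mean_mul_pow x hx 0 (by omega)
    rw [mul_zero, Nat.sub_zero] at this
    rw [this, Nat.choose_zero_right]
    simp
  · intro j hj hj0
    have hje : j ≤ e := Nat.lt_succ_iff.1 (Finset.mem_range.1 hj)
    rw [hterm]
    apply mul_eq_zero_of_right
    rcases Nat.even_or_odd j with ⟨h, hh⟩ | hodd
    · obtain ⟨κ, hκ⟩ := exists_momentMap_orthogonal_even hd hx hbx h
      rw [show j = 2 * h by omega, hκ]
      have := hC.mean_one_sub_sq_pow_mul hx (h - 1) 0 (by omega)
      rw [show h - 1 + 1 = h by omega, mul_zero, Nat.sub_zero] at this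
      rw [this, mul_zero]
    · exact momentMap_orthogonal_odd_aeval hd hbx hodd _
  · simp

theorem mean_mul_of_odd (hC : IsHomogeneousKernel d e C) (hd : 2 ≤ d) (x : Fin d → ℝ) {m : ℕ}
    (hm : Odd (e + m)) {f : MvPolynomial (Fin d) ℝ} (hf : f.IsHomogeneous m) :
    sphereMean (Polynomial.aeval (linForm x) C * f) = 0 := by
  rw [← momentMap_real, Polynomial.aeval_eq_sum_range, Finset.sum_mul, map_sum]
  refine Finset.sum_eq_zero fun j hj => ?_
  rw [smul_mul_assoc, map_smul, momentMap_real]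
  by_cases h0 : C.coeff j = 0
  · rw [h0, zero_smul]
  · obtain ⟨c, hc⟩ := hC.parity j h0
    obtain ⟨c', hc'⟩ := hm
    have hj' := Finset.mem_range.1 hj
    have := hC.natDegree_le
    have hhom := ((linForm_isHomogeneous x).pow j).mul hf
    rw [one_mul] at hhom
    rw [sphereMean_eq_zero_of_odd hd ⟨c' - c, by omega⟩ hhom, smul_zero]

end IsHomogeneousKernel

end ZonalMean

/-! ### Tight designs are distance sets. -/

section Converse

open MvPolynomial

variable {d : ℕ}

theorem eq_zero_of_isHomogeneous_of_sphere {n : ℕ} {f : MvPolynomial (Fin d) ℝ}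
    (hf : f.IsHomogeneous n) (h : ∀ v : Fin d → ℝ, v ⬝ᵥ v = 1 → eval v f = 0)
    (hd : 2 ≤ d) : f = 0 := by
  have hne : ∀ v : Fin d → ℝ, v ≠ 0 → eval v f = 0 := by
    intro v hv0
    have hv : 0 < v ⬝ᵥ v := by
      refine lt_of_le_of_ne (Finset.sum_nonneg fun i _ => mul_self_nonneg _) (Ne.symm ?_)
      simpa [dotProduct_self_eq_zero] using hv0
    have hs := Real.sqrt_pos.2 hv
    have h1 := h ((Real.sqrt (v ⬝ᵥ v))⁻¹ • v) (by
      rw [smul_dotProduct, dotProduct_smul, smul_eq_mul, smul_eq_mul, ← mul_assoc, ← mul_inv,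
        Real.mul_self_sqrt hv.le, inv_mul_cancel₀ hv.ne'])
    rw [eval_smul_of_isHomogeneous hf] at h1
    exact (mul_eq_zero.1 h1).resolve_left (pow_ne_zero _ (inv_ne_zero hs.ne'))
  rcases Nat.eq_zero_or_pos n with rfl | hn
  · have hC := (totalDegree_zero_iff_isHomogeneous _).2 hf
    rw [totalDegree_eq_zero_iff_eq_C] at hC
    have := hne (fun _ => 1) (fun h0 => by
      have := congrFun h0 ⟨0, by omega⟩
      simp at this)
    rw [hC, eval_C] at this
    rw [hC, this, C_0]
  · refine MvPolynomial.funext fun v => ?_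
    rw [map_zero]
    by_cases hv0 : v = 0
    · have := eval_smul_of_isHomogeneous hf 0 v
      rw [zero_smul, zero_pow hn.ne', zero_mul] at this
      rw [hv0, this]
    · exact hne v hv0

theorem exists_eq_add_of_mem_restrictSupport_union {S T : Finset (Fin d →₀ ℕ)}
    [DecidableEq (Fin d →₀ ℕ)] {f : MvPolynomial (Fin d) ℝ}
    (hf : f ∈ restrictSupport ℝ ((S ∪ T : Finset _) : Set (Fin d →₀ ℕ))) :
    ∃ g ∈ restrictSupport ℝ (S : Set (Fin d →₀ ℕ)), ∃ h ∈ restrictSupport ℝ (T : Set (Fin d →₀ ℕ)),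
      g + h = f := by
  rw [Finset.coe_union, restrictSupport_eq_span, Set.image_union, Submodule.span_union,
    ← restrictSupport_eq_span, ← restrictSupport_eq_span] at hf
  exact Submodule.mem_sup.1 hf

/-- Comparing `v` with `-v` separates the two parities. -/
theorem eq_zero_of_sphere_of_union {n : ℕ} (hd : 2 ≤ d) (hn : 1 ≤ n)
    {f g : MvPolynomial (Fin d) ℝ} (hf : f.IsHomogeneous n) (hg : g.IsHomogeneous (n - 1))
    (h : ∀ v : Fin d → ℝ, v ⬝ᵥ v = 1 → eval v (f + g) = 0) : f + g = 0 := by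
  have hodd : ((-1 : ℝ)) ^ n = -(-1) ^ (n - 1) := by
    obtain ⟨m, rfl⟩ : ∃ m, n = m + 1 := ⟨n - 1, by omega⟩
    rw [Nat.add_sub_cancel, pow_succ]
    ring
  have hpow : ((-1 : ℝ)) ^ (n - 1) ≠ 0 := pow_ne_zero _ (by norm_num)
  have key : ∀ v : Fin d → ℝ, v ⬝ᵥ v = 1 → eval v f = 0 ∧ eval v g = 0 := by
    intro v hv
    have h1 := h v hv
    have h2 := h ((-1 : ℝ) • v) (by simp [hv])
    rw [map_add] at h1 h2
    rw [eval_smul_of_isHomogeneous hf, eval_smul_of_isHomogeneous hg, hodd] at h2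
    have h3 : eval v g - eval v f = 0 := by
      apply (mul_eq_zero.1 (?_ : (-1 : ℝ) ^ (n - 1) * (eval v g - eval v f) = 0)).resolve_left hpow
      linarith
    constructor <;> linarith
  rw [eq_zero_of_isHomogeneous_of_sphere hf (fun v hv => (key v hv).1) hd,
    eq_zero_of_isHomogeneous_of_sphere hg (fun v hv => (key v hv).2) hd, add_zero]

variable {X : Finset (EuclideanSpace ℝ (Fin d))} {w : EuclideanSpace ℝ (Fin d) → ℝ} {t : ℕ}

/-- The design integrates `f²` exactly, so `f²` has mean zero. -/
theorem IsWeightedSphericalDesign.eval_eq_zero_of_sq (h : IsWeightedSphericalDesign X w t)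
    (hd : 2 ≤ d) {f : MvPolynomial (Fin d) ℝ} (hf : 2 * f.totalDegree ≤ t)
    (h0 : ∀ x ∈ X, eval (fun i => x i) f = 0) (v : Fin d → ℝ) (hv : v ⬝ᵥ v = 1) :
    eval v f = 0 := by
  have hmean := h.mean_eq (f * f) ((totalDegree_mul _ _).trans (by omega))
  rw [Finset.sum_eq_zero fun x hx => by rw [map_mul, h0 x hx]; ring] at hmean
  have := eval_eq_zero_of_sphereMean_eq_zero_vec hd
    (fun v _ => by rw [map_mul]; exact mul_self_nonneg _) hmean v hv
  rw [map_mul] at this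
  exact mul_self_eq_zero.1 this

theorem IsWeightedSphericalDesign.exists_eval_ne_zero (h : IsWeightedSphericalDesign X w t)
    (hd : 2 ≤ d) {x : EuclideanSpace ℝ (Fin d)} (hx : x ∈ X) {q : ℝ[X]} (hq : q ≠ 0)
    (hdeg : q.natDegree ≤ t) (hnn : ∀ s ∈ Set.Icc (-1 : ℝ) 1, 0 ≤ q.eval s) :
    ∃ y ∈ X, q.eval (inner ℝ x y) ≠ 0 := by
  by_contra hcon
  push Not at hcon
  have hmean := h.mean_eq (Polynomial.aeval (linForm fun i => x i) q)
    ((totalDegree_aeval_linForm_le _ _).trans hdeg)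
  rw [Finset.sum_eq_zero fun y hy => by
    rw [eval_aeval_linForm, dotProduct_eq_inner, hcon y hy, mul_zero]] at hmean
  exact hq (eq_zero_of_sphereMean_aeval_eq_zero hd
    (dotProduct_self_of_norm_eq_one (norm_eq_one_of_onUnitSphere h.onSphere hx)) hnn hmean)

theorem IsWeightedSphericalDesign.nonempty (h : IsWeightedSphericalDesign X w t) :
    X.Nonempty := by
  rw [Finset.nonempty_iff_ne_empty]
  rintro rfl
  simpa using h.weight_sum

theorem localDistanceSet_subset_distanceSet {x : EuclideanSpace ℝ (Fin d)} (hx : x ∈ X) :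
    localDistanceSet X x ⊆ distanceSet X := by
  classical
  intro s hs
  simp only [localDistanceSet, distanceSet, Finset.mem_image, Finset.mem_erase,
    Finset.mem_offDiag] at hs ⊢
  obtain ⟨y, ⟨hyx, hy⟩, rfl⟩ := hs
  exact ⟨(x, y), ⟨hx, hy, hyx.symm⟩, rfl⟩

theorem card_distanceSet_le_of_inner_mem (hX : OnUnitSphere X) (S : Finset ℝ)
    (h : ∀ x ∈ X, ∀ y ∈ X, x ≠ y → inner ℝ x y ∈ S) : (distanceSet X).card ≤ S.card := by
  classical
  have : distanceSet X ⊆ S.image fun s => Real.sqrt (2 - 2 * s) := by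
    intro s hs
    simp only [distanceSet, Finset.mem_image, Finset.mem_offDiag] at hs ⊢
    obtain ⟨⟨x, y⟩, ⟨hx, hy, hxy⟩, rfl⟩ := hs
    exact ⟨inner ℝ x y, h x hx y hy hxy,
      (dist_eq_of_inner (norm_eq_one_of_onUnitSphere hX hx)
        (norm_eq_one_of_onUnitSphere hX hy)).symm⟩
  exact (Finset.card_le_card this).trans Finset.card_image_le

theorem dist_mem_distanceSet {x y : EuclideanSpace ℝ (Fin d)} (hx : x ∈ X) (hy : y ∈ X)
    (hxy : x ≠ y) : dist x y ∈ distanceSet X := by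
  classical
  exact Finset.mem_image.2 ⟨(x, y), Finset.mem_offDiag.2 ⟨hx, hy, hxy⟩, rfl⟩

/-- The polynomial whose roots are the inner products corresponding to the distances in `D`. -/
noncomputable def distancePolynomial (D : Finset ℝ) : ℝ[X] :=
  ∏ t ∈ D, (Polynomial.X - Polynomial.C (1 - t ^ 2 / 2))

theorem distancePolynomial_ne_zero (D : Finset ℝ) : distancePolynomial D ≠ 0 :=
  (Polynomial.monic_prod_of_monic _ _ fun _ _ => Polynomial.monic_X_sub_C _).ne_zero

theorem distancePolynomial_natDegree (D : Finset ℝ) :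
    (distancePolynomial D).natDegree = D.card := by
  rw [distancePolynomial, Polynomial.natDegree_prod_of_monic _ _
    fun _ _ => Polynomial.monic_X_sub_C _]
  simp only [Polynomial.natDegree_X_sub_C, Finset.sum_const, smul_eq_mul, mul_one]

theorem distancePolynomial_eval_inner {D : Finset ℝ} {x y : EuclideanSpace ℝ (Fin d)}
    (hx : ‖x‖ = 1) (hy : ‖y‖ = 1) (h : dist x y ∈ D) :
    (distancePolynomial D).eval (inner ℝ x y) = 0 := by
  rw [distancePolynomial, Polynomial.eval_prod]
  refine Finset.prod_eq_zero h ?_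
  rw [inner_eq_of_dist hx hy]
  simp

/-- With fewer than `k` distances, `(1 - s) p(s)²` has degree at most `2k - 1`, is nonnegative on
`[-1,1]`, and vanishes on `X`: the factor `1 - s` handles `x` itself, `p` every other point. -/
theorem IsWeightedSphericalDesign.le_card_distanceSet {k : ℕ} (hd : 2 ≤ d)
    (h : IsWeightedSphericalDesign X w (2 * k)) : k ≤ (distanceSet X).card := by
  by_contra hlt
  rw [not_le] at hlt
  obtain ⟨x, hx⟩ := h.nonempty
  have hnorm := fun x hx => norm_eq_one_of_onUnitSphere h.onSphere (x := x) hx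
  set p := distancePolynomial (distanceSet X) with hp
  have hp0 : p ≠ 0 := distancePolynomial_ne_zero _
  have hpd : p.natDegree = (distanceSet X).card := distancePolynomial_natDegree _
  have h1 : (1 - Polynomial.X : ℝ[X]) ≠ 0 := fun h => by
    have := congrArg (Polynomial.eval 0) h
    simp at this
  have h1d : (1 - Polynomial.X : ℝ[X]).natDegree ≤ 1 :=
    (Polynomial.natDegree_sub_le _ _).trans (by simp)
  obtain ⟨y, hy, hne⟩ := h.exists_eval_ne_zero hd hx
    (q := (1 - Polynomial.X) * p ^ 2) (mul_ne_zero h1 (pow_ne_zero 2 hp0))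
    (by
      refine Polynomial.natDegree_mul_le.trans ?_
      rw [Polynomial.natDegree_pow, hpd]
      omega)
    (fun s hs => by
      simp only [Polynomial.eval_mul, Polynomial.eval_sub, Polynomial.eval_one, Polynomial.eval_X,
        Polynomial.eval_pow]
      exact mul_nonneg (by linarith [hs.2]) (sq_nonneg _))
  apply hne
  rw [Polynomial.eval_mul, Polynomial.eval_pow]
  by_cases hxy : x = y
  · subst hxy
    rw [real_inner_self_eq_norm_sq, hnorm x hx]
    simp
  · rw [hp, distancePolynomial_eval_inner (hnorm x hx) (hnorm y hy)
      (dist_mem_distanceSet hx hy hxy)]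
    simp

/-- The factor `1 - s²` handles both `x` and `-x`, so `p` can omit the distance between them; the
degree stays at most `2k - 2`. -/
theorem IsWeightedSphericalDesign.le_card_distanceSet_of_isAntipodal {k : ℕ} (hd : 2 ≤ d)
    (h : IsWeightedSphericalDesign X w (2 * k - 1)) (hanti : IsAntipodal X) :
    k ≤ (distanceSet X).card := by
  by_contra hlt
  rw [not_le] at hlt
  obtain ⟨x, hx⟩ := h.nonempty
  have hnorm := fun x hx => norm_eq_one_of_onUnitSphere h.onSphere (x := x) hx
  have hxn := neg_ne_of_norm_eq_one (hnorm x hx)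
  have h2mem := dist_mem_distanceSet hx (hanti x hx) hxn.symm
  have hcard := Finset.card_erase_add_one h2mem
  set p := distancePolynomial ((distanceSet X).erase (dist x (-x))) with hp
  have hp0 : p ≠ 0 := distancePolynomial_ne_zero _
  have hpd : p.natDegree = ((distanceSet X).erase (dist x (-x))).card :=
    distancePolynomial_natDegree _
  have h1 : (1 - Polynomial.X ^ 2 : ℝ[X]) ≠ 0 := fun h => by
    have := congrArg (Polynomial.eval 0) h
    simp at this
  have h1d : (1 - Polynomial.X ^ 2 : ℝ[X]).natDegree ≤ 2 :=
    (Polynomial.natDegree_sub_le _ _).trans (by simp)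
  obtain ⟨y, hy, hne⟩ := h.exists_eval_ne_zero hd hx
    (q := (1 - Polynomial.X ^ 2) * p ^ 2) (mul_ne_zero h1 (pow_ne_zero 2 hp0))
    (by
      refine Polynomial.natDegree_mul_le.trans ?_
      rw [Polynomial.natDegree_pow, hpd]
      omega)
    (fun s hs => by
      simp only [Polynomial.eval_mul, Polynomial.eval_sub, Polynomial.eval_one, Polynomial.eval_X,
        Polynomial.eval_pow]
      exact mul_nonneg (by nlinarith [hs.1, hs.2]) (sq_nonneg _))
  apply hne
  rw [Polynomial.eval_mul, Polynomial.eval_pow]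
  by_cases hxy : x = y
  · subst hxy
    rw [real_inner_self_eq_norm_sq, hnorm x hx]
    simp
  by_cases hxy' : y = -x
  · subst hxy'
    rw [inner_neg_right, real_inner_self_eq_norm_sq, hnorm x hx]
    simp
  · rw [hp, distancePolynomial_eval_inner (hnorm x hx) (hnorm y hy)]
    · simp
    · refine Finset.mem_erase.2 ⟨fun h => hxy' ?_, dist_mem_distanceSet hx hy hxy⟩
      have h3 := inner_eq_of_dist (hnorm x hx) (hnorm y hy)
      have h4 := inner_eq_of_dist (hnorm x hx) (hnorm _ (hanti x hx))
      rw [h, ← h4, inner_neg_right, real_inner_self_eq_norm_sq, hnorm x hx] at h3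
      by_contra hne
      have := inner_lt_one (x := x) (y := -y) (hnorm x hx) (hnorm _ (hanti y hy))
        (fun h => hne (by rw [h, neg_neg]))
      rw [inner_neg_right, h3] at this
      norm_num at this

theorem isKDistanceSet_of_card_bounds {k : ℕ} (h1 : (distanceSet X).card ≤ k)
    (h2 : k ≤ (distanceSet X).card) : IsLocallyKDistanceSet k X ∧ IsKDistanceSet k X :=
  ⟨fun _ hx => (Finset.card_le_card (localDistanceSet_subset_distanceSet hx)).trans h1,
    le_antisymm h1 h2⟩

/-- Tight designs of even strength are distance sets. -/
theorem IsTightWeightedSphericalDesign.isKDistanceSet {k : ℕ} (hd : 2 ≤ d) (hk : 1 ≤ k)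
    (h : IsTightWeightedSphericalDesign X w (2 * k)) :
    IsLocallyKDistanceSet k X ∧ IsKDistanceSet k X := by
  classical
  obtain ⟨h, hcard⟩ := h
  rw [fisherBound, if_pos (even_two_mul k), Nat.mul_div_cancel_left k two_pos] at hcard
  refine isKDistanceSet_of_card_bounds ?_ (h.le_card_distanceSet hd)
  have hunit : ∀ x ∈ X, (fun i => x i) ⬝ᵥ (fun i => x i) = (1 : ℝ) := fun x hx =>
    dotProduct_self_of_norm_eq_one (norm_eq_one_of_onUnitSphere h.onSphere hx)
  set T := degreeExponents d k ∪ degreeExponents d (k - 1) with hT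
  have hTcard : X.card = T.card := by
    rw [hT, Finset.card_union_of_disjoint, card_degreeExponents, card_degreeExponents, hcard,
      fisherN, show d + (k - 1) - 1 = d + k - 2 by omega]
    rw [Finset.disjoint_left]
    intro α h1 h2
    rw [mem_degreeExponents] at h1 h2
    omega
  have hdecomp : ∀ f ∈ restrictSupport ℝ (T : Set (Fin d →₀ ℕ)),
      ∃ f₁ f₂ : MvPolynomial (Fin d) ℝ, f₁.IsHomogeneous k ∧ f₂.IsHomogeneous (k - 1) ∧
        f₁ + f₂ = f := by
    intro f hf
    obtain ⟨f₁, h₁, f₂, h₂, h12⟩ := exists_eq_add_of_mem_restrictSupport_union hf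
    exact ⟨f₁, f₂, isHomogeneous_iff_mem_restrictSupport.2 h₁,
      isHomogeneous_iff_mem_restrictSupport.2 h₂, h12⟩
  have hdegT : ∀ f ∈ restrictSupport ℝ (T : Set (Fin d →₀ ℕ)), f.totalDegree ≤ k := by
    intro f hf
    obtain ⟨f₁, f₂, h₁, h₂, rfl⟩ := hdecomp f hf
    exact (totalDegree_add _ _).trans (max_le h₁.totalDegree_le
      (h₂.totalDegree_le.trans (Nat.sub_le k 1)))
  have hinj : Function.Injective (evalFamily (T : Set (Fin d →₀ ℕ)) fun (x : X) i => x.1 i) := by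
    rw [injective_iff_map_eq_zero]
    rintro ⟨f, hf⟩ h0
    have hdeg := hdegT f hf
    have hz := h.eval_eq_zero_of_sq hd (f := f) (by omega)
      (fun x hx => by simpa using congrFun h0 ⟨x, hx⟩)
    obtain ⟨f₁, f₂, h₁, h₂, rfl⟩ := hdecomp f hf
    exact Subtype.ext (eq_zero_of_sphere_of_union hd hk h₁ h₂ hz)
  have hsurj := (LinearMap.injective_iff_surjective_of_finrank_eq_finrank
    (by rw [finrank_restrictSupport, Module.finrank_fintype_fun_eq_card, Fintype.card_coe,
      hTcard])).1 hinj
  obtain ⟨C₁, hC₁⟩ := exists_isHomogeneousKernel hd k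
  obtain ⟨C₂, hC₂⟩ := exists_isHomogeneousKernel hd (k - 1)
  set ψ := C₁ + C₂ with hψ
  have hψdeg : ψ.natDegree ≤ k := (Polynomial.natDegree_add_le _ _).trans
    (max_le hC₁.natDegree_le (hC₂.natDegree_le.trans (Nat.sub_le k 1)))
  -- The cross terms between degrees `k` and `k - 1` are odd and have mean zero, so the sum of the
  -- two kernels reproduces the direct sum.
  have hrep : ∀ x : Fin d → ℝ, x ⬝ᵥ x = 1 → ∀ f ∈ restrictSupport ℝ (T : Set (Fin d →₀ ℕ)),
      sphereMean (Polynomial.aeval (linForm x) ψ * f) = eval x f := by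
    intro x hx f hf
    obtain ⟨f₁, f₂, h₁, h₂, rfl⟩ := hdecomp f hf
    have e1 := hC₁.mean_mul hd hx h₁
    have e2 := hC₂.mean_mul hd hx h₂
    have e3 := hC₁.mean_mul_of_odd hd x (m := k - 1) ⟨k - 1, by omega⟩ h₂
    have e4 := hC₂.mean_mul_of_odd hd x (m := k) ⟨k - 1, by omega⟩ h₁
    rw [← sphereMeanLinear_apply] at e1 e2 e3 e4 ⊢
    rw [hψ, map_add, add_mul, mul_add, mul_add, map_add, map_add, map_add, e1, e2, e3, e4, map_add]
    ring
  -- Take `f` in the space equal to the indicator of `z` on `X` and reproduce `f(x)` by the design;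
  -- the degree is at most `2k`, and only the node `z` contributes.
  have hdelta : ∀ x ∈ X, ∀ z ∈ X, w z * ψ.eval (inner ℝ x z) = if x = z then 1 else 0 := by
    intro x hx z hz
    obtain ⟨⟨f, hf⟩, hfz⟩ := hsurj (Pi.single ⟨z, hz⟩ 1)
    have hval : ∀ y ∈ X, eval (fun i => y i) f = if y = z then 1 else 0 := fun y hy => by
      have := congrFun hfz ⟨y, hy⟩
      rw [evalFamily_apply, Pi.single_apply] at this
      simpa [Subtype.ext_iff] using this
    have h1 := hrep _ (hunit x hx) f hf
    rw [hval x hx, h.mean_eq] at h1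
    · rw [← h1, Finset.sum_eq_single z]
      · rw [map_mul, hval z hz, if_pos rfl, eval_aeval_linForm, dotProduct_eq_inner, mul_one]
      · intro y hy hyz
        rw [map_mul, hval y hy, if_neg hyz, mul_zero, mul_zero]
      · exact fun hn => absurd hz hn
    · refine (totalDegree_mul _ _).trans ?_
      have := totalDegree_aeval_linForm_le (fun i => x i) ψ
      have := hdegT f hf
      omega
  obtain ⟨x₀, hx₀⟩ := h.nonempty
  have hψ0 : ψ ≠ 0 := by
    intro h0
    have := hdelta x₀ hx₀ x₀ hx₀
    rw [h0] at this
    simp at this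
  refine (card_distanceSet_le_of_inner_mem h.onSphere ψ.roots.toFinset
    fun x hx y hy hxy => ?_).trans
    ((Multiset.toFinset_card_le _).trans ((Polynomial.card_roots' ψ).trans hψdeg))
  rw [Multiset.mem_toFinset, Polynomial.mem_roots hψ0, Polynomial.IsRoot]
  have := hdelta x hx y hy
  rw [if_neg hxy] at this
  exact (mul_eq_zero.1 this).resolve_left (h.weight_pos y hy).ne'

/-- By reproduction, the matrix `C((x,y)) w(y)` is a projection onto the restrictions of `Hom_e` to
`X`. Its trace is `C(1) ∑ w = C(1)`, and its rank is the dimension of `Hom_e`. -/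
theorem IsWeightedSphericalDesign.kernel_eval_one {e : ℕ} (hd : 2 ≤ d)
    (h : IsWeightedSphericalDesign X w t) (ht : 2 * e ≤ t) {C : ℝ[X]}
    (hC : IsHomogeneousKernel d e C) : C.eval 1 = ((degreeExponents d e).card : ℝ) := by
  classical
  have hunit : ∀ x ∈ X, (fun i => x i) ⬝ᵥ (fun i => x i) = (1 : ℝ) := fun x hx =>
    dotProduct_self_of_norm_eq_one (norm_eq_one_of_onUnitSphere h.onSphere hx)
  set T := degreeExponents d e with hT
  set E := evalFamily (T : Set (Fin d →₀ ℕ)) fun (x : X) i => x.1 i with hE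
  have hinj : Function.Injective E := by
    rw [injective_iff_map_eq_zero]
    rintro ⟨f, hf⟩ h0
    have hfh := isHomogeneous_iff_mem_restrictSupport.2 hf
    have hdeg := hfh.totalDegree_le
    have hz := h.eval_eq_zero_of_sq hd (f := f) (by omega)
      (fun x hx => by simpa [hE] using congrFun h0 ⟨x, hx⟩)
    exact Subtype.ext (eq_zero_of_isHomogeneous_of_sphere hfh hz hd)
  let A : Matrix X X ℝ := Matrix.of fun x y => C.eval (inner ℝ x.1 y.1) * w y
  have hproj : LinearMap.IsProj (LinearMap.range E) (Matrix.toLin' A) := by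
    refine ⟨fun g => ?_, ?_⟩
    · refine ⟨⟨∑ y : X, (w y * g y) • zonal e (fun i => y.1 i) C, ?_⟩, ?_⟩
      · refine Submodule.sum_mem _ fun y _ => Submodule.smul_mem _ _ ?_
        rw [← isHomogeneous_iff_mem_restrictSupport]
        exact zonal_isHomogeneous _ _ fun j _ hj => hC.parity j hj
      · ext x
        rw [hE, evalFamily_apply, Matrix.toLin'_apply, Matrix.mulVec, dotProduct, map_sum]
        refine Finset.sum_congr rfl fun y _ => ?_
        rw [smul_eval, eval_zonal _ hC.natDegree_le (hunit x x.2), dotProduct_eq_inner,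
          real_inner_comm]
        simp only [A, Matrix.of_apply]
        ring
    · rintro _ ⟨⟨f, hf⟩, rfl⟩
      ext x
      have hfh := isHomogeneous_iff_mem_restrictSupport.2 hf
      have h1 := hC.mean_mul hd (hunit x x.2) hfh
      rw [h.mean_eq _ (by
        refine (totalDegree_mul _ _).trans ?_
        have := totalDegree_aeval_linForm_le (fun i => x.1 i) C
        have := hC.natDegree_le
        have := hfh.totalDegree_le
        omega)] at h1
      rw [Matrix.toLin'_apply, Matrix.mulVec, dotProduct, hE, evalFamily_apply, ← h1,
        ← Finset.sum_coe_sort X]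
      refine Finset.sum_congr rfl fun y _ => ?_
      rw [map_mul, eval_aeval_linForm, dotProduct_eq_inner, evalFamily_apply]
      simp only [A, Matrix.of_apply]
      ring
  have htr := hproj.trace
  rw [LinearMap.finrank_range_of_inj hinj, finrank_restrictSupport, Matrix.trace_toLin'_eq,
    Matrix.trace] at htr
  rw [← htr]
  have : ∀ x : X, A.diag x = C.eval 1 * w x := fun x => by
    simp only [A, Matrix.diag_apply, Matrix.of_apply]
    rw [real_inner_self_eq_norm_sq, norm_eq_one_of_onUnitSphere h.onSphere x.2, one_pow]
  rw [Finset.sum_congr rfl fun x _ => this x, ← Finset.mul_sum, Finset.sum_coe_sort X w,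
    h.weight_sum, mul_one]

/-- Tight designs of odd strength are antipodal distance sets. -/
theorem IsTightWeightedSphericalDesign.isAntipodal_isKDistanceSet {k : ℕ} (hd : 2 ≤ d)
    (hk : 1 ≤ k) (h : IsTightWeightedSphericalDesign X w (2 * k - 1)) :
    IsAntipodal X ∧ IsLocallyKDistanceSet k X ∧ IsKDistanceSet k X := by
  classical
  obtain ⟨h, hcard⟩ := h
  rw [fisherBound, if_neg (by rw [Nat.even_iff]; omega), show (2 * k - 1 + 1) / 2 = k by omega,
    fisherN'] at hcard
  have hnorm := fun x hx => norm_eq_one_of_onUnitSphere h.onSphere (x := x) hx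
  have hunit : ∀ x ∈ X, (fun i => x i) ⬝ᵥ (fun i => x i) = (1 : ℝ) := fun x hx =>
    dotProduct_self_of_norm_eq_one (hnorm x hx)
  obtain ⟨C, hC⟩ := exists_isHomogeneousKernel hd (k - 1)
  have hC1 := h.kernel_eval_one hd (e := k - 1) (by omega) hC
  have hXcard : (X.card : ℝ) = 2 * C.eval 1 := by
    rw [hC1, card_degreeExponents, hcard, show d + (k - 1) - 1 = d + k - 2 by omega]
    push_cast
    ring
  have hC1pos : 0 < C.eval 1 := by
    have : 0 < (X.card : ℝ) := by exact_mod_cast Finset.card_pos.2 h.nonempty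
    linarith
  -- Reproducing the zonal polynomial of `C` itself gives `C(1)`; the part with the extra factor `c
  -- s` is odd and has mean zero. The degree is at most `2(k - 1) + 1`.
  have hsum : ∀ x ∈ X, ∀ c : ℝ,
      ∑ y ∈ X, w y * (C.eval (inner ℝ x y) ^ 2 * (1 + c * inner ℝ x y)) = C.eval 1 := by
    intro x hx c
    set x' : Fin d → ℝ := fun i => x i with hx'
    have hzh : (zonal (k - 1) x' C).IsHomogeneous (k - 1) :=
      zonal_isHomogeneous _ _ fun j _ hj => hC.parity j hj
    have h1 := hC.mean_mul hd (hunit x hx) hzh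
    have h2 := hC.mean_mul_of_odd hd x' (m := 1 + (k - 1)) ⟨k - 1, by omega⟩
      ((linForm_isHomogeneous x').mul hzh)
    rw [← sphereMeanLinear_apply] at h1 h2
    have h3 : sphereMean (Polynomial.aeval (linForm x') C * zonal (k - 1) x' C +
        c • (Polynomial.aeval (linForm x') C * (linForm x' * zonal (k - 1) x' C))) = C.eval 1 := by
      rw [← sphereMeanLinear_apply, map_add, map_smul, h1, h2, smul_zero, add_zero,
        eval_zonal _ hC.natDegree_le (hunit x hx), hunit x hx]
    rw [h.mean_eq] at h3
    · rw [← h3]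
      refine Finset.sum_congr rfl fun y hy => ?_
      rw [map_add, smul_eval, map_mul, map_mul, map_mul, eval_linForm, eval_aeval_linForm,
        eval_zonal _ hC.natDegree_le (hunit y hy), dotProduct_eq_inner]
      ring
    · have d1 := (totalDegree_aeval_linForm_le x' C).trans hC.natDegree_le
      have d2 := hzh.totalDegree_le
      have d3 := ((linForm_isHomogeneous x').mul hzh).totalDegree_le
      refine (totalDegree_add _ _).trans (max_le ?_ ?_)
      · exact (totalDegree_mul _ _).trans (by omega)
      · exact (totalDegree_smul_le _ _).trans ((totalDegree_mul _ _).trans (by omega))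
  have hinner : ∀ x ∈ X, ∀ y ∈ X, -1 ≤ inner ℝ x y ∧ inner ℝ x y ≤ 1 := fun x hx y hy => by
    rw [← dotProduct_eq_inner]
    exact dotProduct_mem_Icc (hunit x hx) (hunit y hy)
  have hterm : ∀ x ∈ X, ∀ y ∈ X,
      0 ≤ w y * (C.eval (inner ℝ x y) ^ 2 * (1 + 1 * inner ℝ x y)) := fun x hx y hy =>
    mul_nonneg (h.weight_pos y hy).le (mul_nonneg (sq_nonneg _) (by linarith [(hinner x hx y hy).1]))
  have hself : ∀ x ∈ X, w x * (C.eval (inner ℝ x x) ^ 2 * (1 + 1 * inner ℝ x x)) =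
      C.eval 1 * (2 * w x * C.eval 1) := fun x hx => by
    rw [real_inner_self_eq_norm_sq, hnorm x hx, one_pow]
    ring
  -- With `c = 1` all terms are nonnegative, so the term at `y = x` is at most the whole sum.
  have hle : ∀ x ∈ X, 2 * w x * C.eval 1 ≤ 1 := fun x hx => by
    have h1 := Finset.single_le_sum (hterm x hx) hx
    rw [hself x hx, hsum x hx 1] at h1
    by_contra hgt
    rw [not_le] at hgt
    have := mul_lt_mul_of_pos_left hgt hC1pos
    linarith
  -- Summed over `X`, both sides equal `2 C(1) = |X|`, so every inequality is an equality.
  have heq : ∀ x ∈ X, 2 * w x * C.eval 1 = 1 := by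
    rw [← Finset.sum_eq_sum_iff_of_le hle, ← Finset.sum_mul, ← Finset.mul_sum, h.weight_sum,
      Finset.sum_const, nsmul_eq_mul, mul_one, mul_one, hXcard]
  have hzero : ∀ x ∈ X, ∀ y ∈ X, x ≠ y → C.eval (inner ℝ x y) = 0 ∨ inner ℝ x y = -1 := by
    intro x hx y hy hxy
    have h1 := hsum x hx 1
    rw [← Finset.add_sum_erase X _ hx, hself x hx, heq x hx, mul_one, add_eq_left,
      Finset.sum_eq_zero_iff_of_nonneg fun y hy => hterm x hx y (Finset.mem_of_mem_erase hy)] at h1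
    have h2 := h1 y (Finset.mem_erase.2 ⟨hxy.symm, hy⟩)
    rcases mul_eq_zero.1 ((mul_eq_zero.1 h2).resolve_left (h.weight_pos y hy).ne') with h3 | h3
    · exact Or.inl (pow_eq_zero_iff two_ne_zero |>.1 h3)
    · exact Or.inr (by linarith)
  have hanti : IsAntipodal X := by
    intro x hx
    -- With `c = -1` the term at `y = x` disappears but the sum is still positive, so some other `y`
    -- has `C((x,y)) ≠ 0`. Then `(x,y) = -1`, that is, `y = -x`.
    have h1 := hsum x hx (-1)
    obtain ⟨y, hy, hne⟩ := Finset.exists_ne_zero_of_sum_ne_zero (h1.trans_ne hC1pos.ne')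
    have hxy : x ≠ y := by
      rintro rfl
      apply hne
      rw [real_inner_self_eq_norm_sq, hnorm x hx]
      ring
    have h2 := (hzero x hx y hy hxy).resolve_left fun h0 => hne (by rw [h0]; ring)
    by_contra hnot
    have := inner_lt_one (x := x) (y := -y) (hnorm x hx) (by rw [norm_neg, hnorm y hy])
      (fun h => hnot (by rw [h, neg_neg]; exact hy))
    rw [inner_neg_right, h2] at this
    norm_num at this
  refine ⟨hanti, isKDistanceSet_of_card_bounds ?_ (h.le_card_distanceSet_of_isAntipodal hd hanti)⟩
  have hC0 : C ≠ 0 := by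
    rintro rfl
    simp at hC1pos
  -- At most `k - 1` roots of `C`, together with `-1`, give at most `k` distances.
  refine (card_distanceSet_le_of_inner_mem h.onSphere (insert (-1) C.roots.toFinset)
    fun x hx y hy hxy => ?_).trans ?_
  · rw [Finset.mem_insert, Multiset.mem_toFinset, Polynomial.mem_roots hC0, Polynomial.IsRoot]
    exact (hzero x hx y hy hxy).symm
  · have h1 := Finset.card_insert_le (-1) C.roots.toFinset
    have h2 := Multiset.toFinset_card_le C.roots
    have h3 := Polynomial.card_roots' C
    have h4 := hC.natDegree_le
    omega

end Converse

theorem theorem2 (d k : ℕ) (hd : 2 ≤ d) (hk : 1 ≤ k) :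
    -- (i), with weight `w(x) = f_k^{(x)}`
    (∀ X : Finset (EuclideanSpace ℝ (Fin d)), OnUnitSphere X →
      IsLocallyKDistanceSet k X → X.card = fisherN d k →
      ∃ f : EuclideanSpace ℝ (Fin d) → ℕ → ℝ,
        (∀ x ∈ X, IsGegenbauerExpansion d k (annihilator k X x) (f x)) ∧
        IsTightWeightedSphericalDesign X (fun x => f x k) (2 * k)) ∧
    (∀ (X : Finset (EuclideanSpace ℝ (Fin d))) (w : EuclideanSpace ℝ (Fin d) → ℝ),
      IsTightWeightedSphericalDesign X w (2 * k) →
      IsLocallyKDistanceSet k X ∧ IsKDistanceSet k X) ∧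
    -- (ii), with weight `w(x) = f_{k-1}^{(x)} / 2`
    (∀ X : Finset (EuclideanSpace ℝ (Fin d)), OnUnitSphere X → IsAntipodal X →
      IsLocallyKDistanceSet k X → X.card = fisherN' d k →
      ∃ f : EuclideanSpace ℝ (Fin d) → ℕ → ℝ,
        (∀ x ∈ X, IsGegenbauerExpansion d (k - 1) (antipodalAnnihilator k X x) (f x)) ∧
        IsTightWeightedSphericalDesign X (fun x => f x (k - 1) / 2) (2 * k - 1)) ∧
    (∀ (X : Finset (EuclideanSpace ℝ (Fin d))) (w : EuclideanSpace ℝ (Fin d) → ℝ),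
      IsTightWeightedSphericalDesign X w (2 * k - 1) →
      IsAntipodal X ∧ IsLocallyKDistanceSet k X ∧ IsKDistanceSet k X) := by
  exact ⟨fun X hX hloc hcard => isTightDesign_of_locallyKDistance hd hk hX hloc hcard,
    fun X w h => h.isKDistanceSet hd hk,
    fun X hX hanti hloc hcard => isTightDesign_of_antipodal_locallyKDistance hd hk hX hanti hloc hcard,
    fun X w h => h.isAntipodal_isKDistanceSet hd hk⟩
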